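/- Let $\mathbb K\in\{\mathbb R,\mathbb C\}$, let $(\Omega,\mathcal F,P)$ be a probability space, and let $L^0(\mathcal F,\mathbb K)$ be the ring of (classes of) $\mathbb K$-valued random variables. Let $(S,\|\cdot\|)$ be a random normed module over $\mathbb K$ with base $(\Omega,\mathcal F,P)$, that is, an $L^0(\mathcal F,\mathbb K)$-module with a map $\|\cdot\|:S\to L^0_+(\mathcal F)$ such that $\|x\|=0\Rightarrow x=0$, $\|\zeta x\|=|\zeta|\,\|x\|$ and $\|x+y\|\le\|x\|+\|y\|$. Give $S$ the $(\varepsilon,\lambda)$-topology, in which $x_i\to x$ means that $\|x_i-x\|\to0$ in probability, and assume that $S$ is complete in it. All limits, derivatives and continuity below refer to the $(\varepsilon,\lambda)$-topologies. Let $B(S)$ be the set of module homomorphisms $T:S\to S$ for which there is $\kappa\in L^0_+(\mathcal F)$ with $\|Tz\|\le\kappa\|z\|$ for all $z\in S$, and let $\|T\|$ be the essential infimum of all such $\kappa$. Let $C\in B(S)$ be injective with range $R(C)$, let $M\in L^0_+(\mathcal F)$ and $\xi\in L^0(\mathcal F,\mathbb R)$, and let $\{W(t)\}_{t\ge0}\subset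 B(S)$ be a $C$-semigroup in $H(M,\xi)$: $CW(s+t)=W(t)W(s)$ for all $s,t\ge0$, $W(0)=C$, $s\mapsto W(s)x$ is continuous for each $x\in S$, and $\|W(s)\|\le Me^{\xi s}$ for all $s\ge0$. Let $(A,D(A))$ be its infinitesimal generator: $x\in D(A)$ if and only if $\lim_{s\to0}(W(s)x-Cx)/s$ exists and belongs to $R(C)$, and then $Ax=C^{-1}\lim_{s\to0}(W(s)x-Cx)/s$. Let $[D(A)]$ be $D(A)$ with the graph $L^0$-norm $\|x\|+\|Ax\|$. Let $\eta\in L^0(\mathcal F,\mathbb R)$ with $\eta>\xi$ on $\Omega$. Then $\eta-A$ is injective and $R(C)\subseteq R(\eta-A)$, so that $R_C(\eta,A):=(\eta-A)^{-1}C$ is defined on all of $S$, and for every $u_0$ in the range of $R_C(\eta,A)$ the following holds. For every $t\ge0$ one has $W(t)u_0\in R(C)$, and the function $$u(t):=C^{-1}W(t)u_0,\qquad t\ge0,$$ which equals $W(t)C^{-1}u_0$ whenever $u_0\in R(C)$, belongs to $C([0,\infty),[D(A)])\cap C^1([0,\infty),S)$ and solves the abstract Cauchy problem $$u'(t)=Au(t)\quad(t>0),\qquad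 u(0)=u_0 .$$ Moreover $u$ is locally $L^0$-Lipschitz, i.e. for every $L>0$ there is $\zeta_L\in L^0_+(\mathcal F)$ with $\|u(s_1)-u(s_2)\|\le\zeta_L|s_1-s_2|$ for all $s_1,s_2\in[0,L]$, and it is the only locally $L^0$-Lipschitz solution in $C([0,\infty),[D(A)])\cap C^1([0,\infty),S)$. -/

import Mathlib

open MeasureTheory Filter Topology Set
open scoped NNReal

noncomputable section

namespace RandomModule

section L0

variable {Ω : Type*} [MeasurableSpace Ω] {P : Measure Ω} {𝕜 : Type*} [RCLike 𝕜]

/-- `Ω →ₘ[P] 𝕜` is the set `L⁰(F, 𝕜)` of equivalence classes of `𝕜`-valued random variables; with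
the pointwise operations (already in Mathlib) it is a commutative ring. -/
instance instCommRingL0 : CommRing (Ω →ₘ[P] 𝕜) :=
  { (AEEqFun.instAddCommGroup : AddCommGroup (Ω →ₘ[P] 𝕜)),
    (AEEqFun.instCommMonoid : CommMonoid (Ω →ₘ[P] 𝕜)) with
    left_distrib := fun a b c => by
      apply AEEqFun.ext
      filter_upwards [AEEqFun.coeFn_mul a (b + c), AEEqFun.coeFn_add b c,
        AEEqFun.coeFn_add (a * b) (a * c), AEEqFun.coeFn_mul a b, AEEqFun.coeFn_mul a c]
        with ω h1 h2 h3 h4 h5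
      simp only [h1, h2, h3, h4, h5, Pi.mul_apply, Pi.add_apply, mul_add]
    right_distrib := fun a b c => by
      apply AEEqFun.ext
      filter_upwards [AEEqFun.coeFn_mul (a + b) c, AEEqFun.coeFn_add a b,
        AEEqFun.coeFn_add (a * c) (b * c), AEEqFun.coeFn_mul a c, AEEqFun.coeFn_mul b c]
        with ω h1 h2 h3 h4 h5
      simp only [h1, h2, h3, h4, h5, Pi.mul_apply, Pi.add_apply, add_mul]
    zero_mul := fun a => by
      apply AEEqFun.ext
      filter_upwards [AEEqFun.coeFn_mul (0 : Ω →ₘ[P] 𝕜) a,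
        (AEEqFun.coeFn_zero : ⇑(0 : Ω →ₘ[P] 𝕜) =ᵐ[P] 0)] with ω h1 h2
      simp only [h1, h2, Pi.mul_apply, Pi.zero_apply, zero_mul]
    mul_zero := fun a => by
      apply AEEqFun.ext
      filter_upwards [AEEqFun.coeFn_mul a (0 : Ω →ₘ[P] 𝕜),
        (AEEqFun.coeFn_zero : ⇑(0 : Ω →ₘ[P] 𝕜) =ᵐ[P] 0)] with ω h1 h2
      simp only [h1, h2, Pi.mul_apply, Pi.zero_apply, mul_zero] }

/-- The modulus `|ζ|` of `ζ ∈ L⁰(F, 𝕜)`. -/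
def modulus (ζ : Ω →ₘ[P] 𝕜) : Ω →ₘ[P] ℝ := ζ.comp (fun z => ‖z‖) continuous_norm

/-- The inclusion `L⁰(F, ℝ) ⊆ L⁰(F, 𝕜)`. -/
def ofRealL0 (𝕜 : Type*) [RCLike 𝕜] (η : Ω →ₘ[P] ℝ) : Ω →ₘ[P] 𝕜 :=
  η.comp (fun r : ℝ => (r : 𝕜)) RCLike.continuous_ofReal

/-- A real number `r`, seen as a constant element of `L⁰(F, 𝕜)`. -/
def constL0 (P : Measure Ω) (𝕜 : Type*) [RCLike 𝕜] (r : ℝ) : Ω →ₘ[P] 𝕜 :=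
  AEEqFun.const Ω (r : 𝕜)

/-- `e^{ξ s} ∈ L⁰(F, ℝ)`. -/
def expL0 (ξ : Ω →ₘ[P] ℝ) (s : ℝ) : Ω →ₘ[P] ℝ :=
  ξ.comp (fun r => Real.exp (r * s)) (by fun_prop)

/-- `G_ξ = {η ∈ L⁰(F, ℝ) : η > ξ on Ω}`. -/
def G (ξ : Ω →ₘ[P] ℝ) : Set (Ω →ₘ[P] ℝ) := {η | ∀ᵐ ω ∂P, ξ ω < η ω}

end L0

/-- An `L⁰`-norm on the `L⁰(F, 𝕜)`-module `S`: the pair `(S, N)` is a random normed module (RN module)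
over `𝕜` with base `(Ω, F, P)`. -/
structure L0Norm {Ω : Type*} [MeasurableSpace Ω] (P : Measure Ω) (𝕜 : Type*) [RCLike 𝕜]
    (S : Type*) [AddCommGroup S] [Module (Ω →ₘ[P] 𝕜) S] where
  nrm : S → (Ω →ₘ[P] ℝ)
  nonneg : ∀ x, 0 ≤ nrm x
  eq_zero_of_nrm_eq_zero : ∀ x, nrm x = 0 → x = 0
  nrm_smul : ∀ (ζ : Ω →ₘ[P] 𝕜) (x : S), nrm (ζ • x) = modulus ζ * nrm x
  nrm_add_le : ∀ x y, nrm (x + y) ≤ nrm x + nrm y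

namespace L0Norm

variable {Ω : Type*} [MeasurableSpace Ω] {P : Measure Ω}
  {𝕜 : Type*} [RCLike 𝕜] {S : Type*} [AddCommGroup S] [Module (Ω →ₘ[P] 𝕜) S]

theorem nrm_smul_ae (N : L0Norm P 𝕜 S) (ζ : Ω →ₘ[P] 𝕜) (x : S) :
    ∀ᵐ ω ∂P, N.nrm (ζ • x) ω = ‖ζ ω‖ * N.nrm x ω := by
  rw [N.nrm_smul]
  filter_upwards [AEEqFun.coeFn_mul (modulus ζ) (N.nrm x),
    AEEqFun.coeFn_comp (fun z : 𝕜 => ‖z‖) continuous_norm ζ] with ω h1 h2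
  rw [h1, Pi.mul_apply, modulus, h2, Function.comp_apply]

theorem nrm_add_ae (N : L0Norm P 𝕜 S) (x y : S) :
    ∀ᵐ ω ∂P, N.nrm (x + y) ω ≤ N.nrm x ω + N.nrm y ω := by
  filter_upwards [AEEqFun.coeFn_le.2 (N.nrm_add_le x y), AEEqFun.coeFn_add (N.nrm x) (N.nrm y)]
    with ω h1 h2
  simpa [h2] using h1

theorem nonneg_ae (N : L0Norm P 𝕜 S) (x : S) : ∀ᵐ ω ∂P, 0 ≤ N.nrm x ω := by
  filter_upwards [AEEqFun.coeFn_le.2 (N.nonneg x),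
    (AEEqFun.coeFn_zero : ⇑(0 : Ω →ₘ[P] ℝ) =ᵐ[P] 0)] with ω h1 h2
  simpa [h2] using h1

theorem nrm_zero_ae (N : L0Norm P 𝕜 S) : ∀ᵐ ω ∂P, N.nrm 0 ω = 0 := by
  have h := N.nrm_smul_ae 0 0
  rw [smul_zero] at h
  filter_upwards [h, (AEEqFun.coeFn_zero : ⇑(0 : Ω →ₘ[P] 𝕜) =ᵐ[P] 0)] with ω h1 h2
  simpa [h2] using h1

theorem nrm_neg_ae (N : L0Norm P 𝕜 S) (x : S) : ∀ᵐ ω ∂P, N.nrm (-x) ω = N.nrm x ω := by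
  have h := N.nrm_smul_ae (-1) x
  rw [neg_one_smul] at h
  filter_upwards [h, AEEqFun.coeFn_neg (1 : Ω →ₘ[P] 𝕜),
    (AEEqFun.coeFn_one : ⇑(1 : Ω →ₘ[P] 𝕜) =ᵐ[P] 1)] with ω h1 h2 h3
  rw [h1, h2]
  simp [h3]

/-- `U_θ(ε, λ) = {z : P(‖z‖ < ε) > 1 - λ}`. -/
def U (N : L0Norm P 𝕜 S) (ε δ : ℝ) : Set S := {z | 1 - δ < P.real {ω | N.nrm z ω < ε}}

theorem mem_U [IsProbabilityMeasure P] (N : L0Norm P 𝕜 S) {ε δ : ℝ} {z : S} :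
    z ∈ N.U ε δ ↔ P.real {ω | ε ≤ N.nrm z ω} < δ := by
  have hm : MeasurableSet {ω | N.nrm z ω < ε} := by
    exact (N.nrm z).measurable measurableSet_Iio
  have hc : {ω | ε ≤ N.nrm z ω} = {ω | N.nrm z ω < ε}ᶜ := by
    ext ω; simp
  rw [hc, probReal_compl_eq_one_sub hm, U, mem_ofPred_eq]
  constructor <;> intro h <;> linarith

/-- `T ∈ B(S)`: the module homomorphism `T` is almost surely bounded. -/
def ASBounded (N : L0Norm P 𝕜 S) (T : S →ₗ[Ω →ₘ[P] 𝕜] S) : Prop :=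
  ∃ κ : Ω →ₘ[P] ℝ, 0 ≤ κ ∧ ∀ z, N.nrm (T z) ≤ κ * N.nrm z

/-- `τ` is the `L⁰`-norm `‖T‖ = ⋀ {κ ∈ L⁰₊(F) : ‖T z‖ ≤ κ ‖z‖ for all z}` of `T`. -/
def IsOpNorm (N : L0Norm P 𝕜 S) (T : S →ₗ[Ω →ₘ[P] 𝕜] S) (τ : Ω →ₘ[P] ℝ) : Prop :=
  IsGLB {κ : Ω →ₘ[P] ℝ | 0 ≤ κ ∧ ∀ z, N.nrm (T z) ≤ κ * N.nrm z} τ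

/-- `‖T‖ ≤ κ`, for `κ ∈ L⁰₊(F)`, in the form `‖T z‖ ≤ κ ‖z‖` for all `z`; the next theorem says that
this is the inequality for the infimum `‖T‖` above. -/
def OpNormLE (N : L0Norm P 𝕜 S) (T : S →ₗ[Ω →ₘ[P] 𝕜] S) (κ : Ω →ₘ[P] ℝ) : Prop :=
  ∀ z, N.nrm (T z) ≤ κ * N.nrm z

theorem le_mul_ae {a b c : Ω →ₘ[P] ℝ} : a ≤ b * c ↔ ∀ᵐ ω ∂P, a ω ≤ b ω * c ω := by
  rw [← AEEqFun.coeFn_le]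
  constructor <;> intro h
  · filter_upwards [h, AEEqFun.coeFn_mul b c] with ω h1 h2
    simpa [h2] using h1
  · filter_upwards [h, AEEqFun.coeFn_mul b c] with ω h1 h2
    simpa [h2] using h1

theorem opNormLE_iff (N : L0Norm P 𝕜 S) {T : S →ₗ[Ω →ₘ[P] 𝕜] S} (hT : N.ASBounded T)
    {τ κ : Ω →ₘ[P] ℝ} (hτ : N.IsOpNorm T τ) (hκ : 0 ≤ κ) : N.OpNormLE T κ ↔ τ ≤ κ := by
  refine ⟨fun h => hτ.1 ⟨hκ, h⟩, fun h z => ?_⟩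
  let q : Ω →ₘ[P] ℝ := AEEqFun.mk (fun ω => N.nrm (T z) ω / N.nrm z ω)
    ((N.nrm (T z)).measurable.div (N.nrm z).measurable).aestronglyMeasurable
  have hq : ⇑q =ᵐ[P] fun ω => N.nrm (T z) ω / N.nrm z ω := AEEqFun.coeFn_mk _ _
  have hlow : q ∈ lowerBounds {κ : Ω →ₘ[P] ℝ | 0 ≤ κ ∧ ∀ z, N.nrm (T z) ≤ κ * N.nrm z} := by
    rintro κ' ⟨hκ0, hκ'⟩
    rw [← AEEqFun.coeFn_le]
    filter_upwards [hq, le_mul_ae.1 (hκ' z), N.nonneg_ae z, AEEqFun.coeFn_le.2 hκ0,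
      (AEEqFun.coeFn_zero : ⇑(0 : Ω →ₘ[P] ℝ) =ᵐ[P] 0)] with ω h1 h2 h3 h4 h5
    rw [h1]
    refine div_le_of_le_mul₀ h3 ?_ h2
    simpa [h5] using h4
  obtain ⟨κ₀, -, hκ₀⟩ := hT
  rw [le_mul_ae]
  filter_upwards [AEEqFun.coeFn_le.2 ((hτ.2 hlow).trans h), hq, N.nonneg_ae z,
    le_mul_ae.1 (hκ₀ z)] with ω h1 h2 h3 h4
  rw [h2] at h1
  rcases h3.eq_or_lt with h0 | h0
  · rw [← h0, mul_zero] at h4 ⊢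
    exact h4
  · exact (div_le_iff₀ h0).1 h1

variable [IsProbabilityMeasure P]

/-- The sets `U_θ(ε, λ)`, `ε > 0`, `0 < λ < 1`, form a basis at `θ` of a group topology. -/
@[reducible] def basis (N : L0Norm P 𝕜 S) : AddGroupFilterBasis S :=
  addGroupFilterBasisOfComm {V | ∃ ε δ : ℝ, 0 < ε ∧ 0 < δ ∧ δ < 1 ∧ V = N.U ε δ}
    ⟨_, 1, 1 / 2, by norm_num, by norm_num, by norm_num, rfl⟩
    (by
      rintro _ _ ⟨ε, δ, hε, hδ, hδ1, rfl⟩ ⟨ε', δ', hε', hδ', hδ1', rfl⟩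
      refine ⟨_, ⟨min ε ε', min δ δ', lt_min hε hε', lt_min hδ hδ', min_lt_of_left_lt hδ1, rfl⟩,
        fun z hz => ?_⟩
      rw [mem_U] at hz
      constructor <;> rw [mem_U]
      · have hsub : {ω | ε ≤ N.nrm z ω} ⊆ {ω | min ε ε' ≤ N.nrm z ω} :=
          fun ω hω => (min_le_left ε ε').trans hω
        exact (measureReal_mono hsub).trans_lt (hz.trans_le (min_le_left _ _))
      · have hsub : {ω | ε' ≤ N.nrm z ω} ⊆ {ω | min ε ε' ≤ N.nrm z ω} :=
          fun ω hω => (min_le_right ε ε').trans hω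
        exact (measureReal_mono hsub).trans_lt (hz.trans_le (min_le_right _ _)))
    (by
      rintro _ ⟨ε, δ, hε, hδ, hδ1, rfl⟩
      rw [mem_U]
      have : P.real {ω | ε ≤ N.nrm 0 ω} = 0 := by
        rw [measureReal_eq_zero_iff]
        refine measure_mono_null (fun ω hω => ?_) N.nrm_zero_ae
        intro h
        have h' : ε ≤ N.nrm 0 ω := hω
        have h'' : N.nrm 0 ω = 0 := h
        linarith
      linarith)
    (by
      rintro _ ⟨ε, δ, hε, hδ, hδ1, rfl⟩
      refine ⟨_, ⟨ε / 2, δ / 2, by linarith, by linarith, by linarith, rfl⟩, ?_⟩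
      rintro _ ⟨x, hx, y, hy, rfl⟩
      rw [mem_U] at hx hy ⊢
      have hle : P.real {ω | ε ≤ N.nrm (x + y) ω} ≤
          P.real ({ω | ε / 2 ≤ N.nrm x ω} ∪ {ω | ε / 2 ≤ N.nrm y ω}) := by
        refine ENNReal.toReal_mono (measure_ne_top _ _) (measure_mono_ae ?_)
        filter_upwards [N.nrm_add_ae x y] with ω h1 h2
        by_contra hcon
        have h3 : ¬ (ε / 2 ≤ N.nrm x ω ∨ ε / 2 ≤ N.nrm y ω) := hcon
        push Not at h3
        have h4 : ε ≤ N.nrm (x + y) ω := h2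
        linarith [h3.1, h3.2]
      have := measureReal_union_le (μ := P) {ω | ε / 2 ≤ N.nrm x ω} {ω | ε / 2 ≤ N.nrm y ω}
      change P.real {ω | ε ≤ N.nrm (x + y) ω} < δ
      linarith)
    (by
      rintro _ ⟨ε, δ, hε, hδ, hδ1, rfl⟩
      refine ⟨_, ⟨ε, δ, hε, hδ, hδ1, rfl⟩, fun z hz => ?_⟩
      rw [mem_U] at hz
      rw [mem_preimage, mem_U]
      refine lt_of_le_of_lt (ENNReal.toReal_mono (measure_ne_top _ _) (measure_mono_ae ?_)) hz
      filter_upwards [N.nrm_neg_ae z] with ω h1 h2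
      have h3 : ε ≤ N.nrm (-z) ω := h2
      rw [h1] at h3
      exact h3)

/-- The `(ε, λ)`-topology on `S`. -/
@[reducible] def topology (N : L0Norm P 𝕜 S) : TopologicalSpace S := N.basis.topology

theorem isTopologicalAddGroup (N : L0Norm P 𝕜 S) : @IsTopologicalAddGroup S N.topology _ :=
  N.basis.isTopologicalAddGroup

/-- The uniform structure of the topological group `(S, T_{ε,λ})`. -/
@[reducible] def uniformSpace (N : L0Norm P 𝕜 S) : UniformSpace S :=
  @IsTopologicalAddGroup.rightUniformSpace S _ N.topology N.isTopologicalAddGroup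

/-- `S` is `T_{ε,λ}`-complete. -/
def IsComplete (N : L0Norm P 𝕜 S) : Prop := @CompleteSpace S N.uniformSpace

/-- Convergence in the `(ε, λ)`-topology is convergence of the `L⁰`-norm in probability. -/
theorem tendsto_iff (N : L0Norm P 𝕜 S) {ι : Type*} {l : Filter ι} {f : ι → S} {x : S} :
    Tendsto f l (@nhds S N.topology x) ↔
      ∀ ε δ : ℝ, 0 < ε → 0 < δ → ∀ᶠ i in l, P.real {ω | ε ≤ N.nrm (f i - x) ω} < δ := by
  rw [(N.basis.nhds_hasBasis x).tendsto_right_iff]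
  constructor
  · intro h ε δ hε hδ
    have := h (N.U ε (min δ (1 / 2))) ⟨ε, _, hε, lt_min hδ (by norm_num),
      min_lt_of_right_lt (by norm_num), rfl⟩
    filter_upwards [this] with i hi
    obtain ⟨y, hy, hyi⟩ := hi
    have : f i - x = y := by rw [← hyi]; simp
    rw [this]
    exact (N.mem_U.1 hy).trans_le (min_le_left _ _)
  · rintro h _ ⟨ε, δ, hε, hδ, -, rfl⟩
    filter_upwards [h ε δ hε hδ] with i hi
    exact ⟨f i - x, N.mem_U.2 hi, by simp⟩

theorem t2Space (N : L0Norm P 𝕜 S) : @T2Space S N.topology := by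
  let _ := N.topology
  have _ := N.isTopologicalAddGroup
  refine IsTopologicalAddGroup.t2Space_of_zero_sep fun x hx => ?_
  by_contra! hcon
  have key : ∀ ε δ : ℝ, 0 < ε → 0 < δ → P.real {ω | ε ≤ N.nrm x ω} < δ := by
    intro ε δ hε hδ
    have hb : N.U ε (min δ (1 / 2)) ∈ N.basis :=
      ⟨ε, _, hε, lt_min hδ (by norm_num), min_lt_of_right_lt (by norm_num), rfl⟩
    exact (N.mem_U.1 (hcon _ (N.basis.mem_nhds_zero hb))).trans_le (min_le_left _ _)
  refine hx (N.eq_zero_of_nrm_eq_zero x (AEEqFun.ext ?_))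
  have h0 : ∀ n : ℕ, ∀ᵐ ω ∂P, N.nrm x ω < 1 / ((n : ℝ) + 1) := by
    intro n
    have hz : P.real {ω | 1 / ((n : ℝ) + 1) ≤ N.nrm x ω} = 0 :=
      le_antisymm (le_of_forall_pos_lt_add fun δ hδ => by
        simpa using key _ δ (by positivity) hδ) measureReal_nonneg
    rw [measureReal_eq_zero_iff] at hz
    rw [ae_iff]
    simpa using hz
  filter_upwards [ae_all_iff.2 h0, N.nonneg_ae x,
    (AEEqFun.coeFn_zero : ⇑(0 : Ω →ₘ[P] ℝ) =ᵐ[P] 0)] with ω h1 h2 h3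
  rw [h3]
  refine le_antisymm (le_of_forall_pos_lt_add fun δ hδ => ?_) h2
  obtain ⟨n, hn⟩ := exists_nat_one_div_lt hδ
  simpa using (h1 n).trans hn

theorem continuous_const_smul (N : L0Norm P 𝕜 S) (ζ : Ω →ₘ[P] 𝕜) {ι : Type*} {l : Filter ι}
    {f : ι → S} {x : S} (h : Tendsto f l (@nhds S N.topology x)) :
    Tendsto (fun i => ζ • f i) l (@nhds S N.topology (ζ • x)) := by
  rw [tendsto_iff] at h ⊢
  intro ε δ hε hδ
  obtain ⟨K, hK⟩ : ∃ K : ℕ, P.real {ω | (K : ℝ) ≤ ‖ζ ω‖} < δ / 2 := by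
    have ht : Tendsto (fun K : ℕ => P {ω | (K : ℝ) ≤ ‖ζ ω‖}) atTop
        (𝓝 (P (⋂ K : ℕ, {ω | (K : ℝ) ≤ ‖ζ ω‖}))) := by
      refine tendsto_measure_iInter_atTop
        (fun K => (ζ.measurable.norm measurableSet_Ici).nullMeasurableSet)
        (fun a b hab ω hω => ?_) ⟨0, measure_ne_top _ _⟩
      have h1 : (b : ℝ) ≤ ‖ζ ω‖ := hω
      have h2 : (a : ℝ) ≤ b := by exact_mod_cast hab
      exact h2.trans h1
    have he : (⋂ K : ℕ, {ω | (K : ℝ) ≤ ‖ζ ω‖}) = ∅ := by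
      ext ω
      simp only [mem_iInter, mem_ofPred_eq, mem_empty_iff_false, iff_false, not_forall, not_le]
      exact exists_nat_gt _
    rw [he, measure_empty] at ht
    have ht' := (ENNReal.tendsto_toReal ENNReal.zero_ne_top).comp ht
    exact (ht'.eventually (gt_mem_nhds (by simpa using half_pos hδ))).exists
  have hK1 : (0 : ℝ) < K + 1 := by positivity
  filter_upwards [h (ε / (K + 1)) (δ / 2) (by positivity) (by positivity)] with i hi
  have hle : P.real {ω | ε ≤ N.nrm (ζ • f i - ζ • x) ω} ≤
      P.real ({ω | (K : ℝ) ≤ ‖ζ ω‖} ∪ {ω | ε / (K + 1) ≤ N.nrm (f i - x) ω}) := by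
    refine ENNReal.toReal_mono (measure_ne_top _ _) (measure_mono_ae ?_)
    rw [← smul_sub]
    filter_upwards [N.nrm_smul_ae ζ (f i - x), N.nonneg_ae (f i - x)] with ω h1 h0 h2
    by_contra hcon
    have h3 : ¬ ((K : ℝ) ≤ ‖ζ ω‖ ∨ ε / (K + 1) ≤ N.nrm (f i - x) ω) := hcon
    push Not at h3
    have h4 : ε ≤ N.nrm (ζ • (f i - x)) ω := h2
    rw [h1] at h4
    have h5 := (lt_div_iff₀ hK1).1 h3.2
    nlinarith [h3.1]
  have := measureReal_union_le (μ := P) {ω | (K : ℝ) ≤ ‖ζ ω‖}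
    {ω | ε / (K + 1) ≤ N.nrm (f i - x) ω}
  linarith

/-- `W`, a family in `B(S)`, is a `C`-semigroup on `S`; the requirement that `C` is an injective
element of `B(S)` is included. -/
structure IsCSemigroup (N : L0Norm P 𝕜 S) (C : S →ₗ[Ω →ₘ[P] 𝕜] S)
    (W : ℝ≥0 → S →ₗ[Ω →ₘ[P] 𝕜] S) : Prop where
  asBounded_C : N.ASBounded C
  injective_C : Function.Injective C
  asBounded : ∀ t, N.ASBounded (W t)
  comp : ∀ s t x, C (W (s + t) x) = W t (W s x)
  zero : W 0 = C
  continuous : ∀ x, @Continuous ℝ≥0 S _ N.topology fun s => W s x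

/-- `H(M, ξ)`: the `C`-semigroups `W` with `‖W(s)‖ ≤ M e^{ξ s}` for all `s ≥ 0`. -/
def H (N : L0Norm P 𝕜 S) (C : S →ₗ[Ω →ₘ[P] 𝕜] S) (M ξ : Ω →ₘ[P] ℝ) :
    Set (ℝ≥0 → S →ₗ[Ω →ₘ[P] 𝕜] S) :=
  {W | N.IsCSemigroup C W ∧ ∀ s : ℝ≥0, N.OpNormLE (W s) (M * expL0 ξ s)}

/-- The graph of the infinitesimal generator: the pairs `(x, y)` with
`lim_{s → 0} (W(s) x - C x) / s = C y`. -/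
def generatorGraph (N : L0Norm P 𝕜 S) (C : S →ₗ[Ω →ₘ[P] 𝕜] S)
    (W : ℝ≥0 → S →ₗ[Ω →ₘ[P] 𝕜] S) : Submodule (Ω →ₘ[P] 𝕜) (S × S) where
  carrier := {p | Tendsto (fun s : ℝ≥0 => constL0 P 𝕜 ((s : ℝ)⁻¹) • (W s p.1 - C p.1))
    (𝓝[>] 0) (@nhds S N.topology (C p.2))}
  add_mem' := by
    rintro ⟨x, y⟩ ⟨x', y'⟩ h h'
    let _ := N.topology
    have _ := N.isTopologicalAddGroup
    have h1 : Tendsto (fun s : ℝ≥0 => constL0 P 𝕜 ((s : ℝ)⁻¹) • (W s x - C x))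
      (𝓝[>] 0) (𝓝 (C y)) := h
    have h2 : Tendsto (fun s : ℝ≥0 => constL0 P 𝕜 ((s : ℝ)⁻¹) • (W s x' - C x'))
      (𝓝[>] 0) (𝓝 (C y')) := h'
    have h3 := h1.add h2
    change Tendsto (fun s : ℝ≥0 => constL0 P 𝕜 ((s : ℝ)⁻¹) • (W s (x + x') - C (x + x')))
      (𝓝[>] 0) (𝓝 (C (y + y')))
    rw [map_add C y y']
    refine h3.congr fun s => ?_
    rw [map_add, map_add, ← smul_add]
    congr 1
    abel
  zero_mem' := by
    let _ := N.topology
    change Tendsto (fun s : ℝ≥0 => constL0 P 𝕜 ((s : ℝ)⁻¹) • (W s (0 : S) - C (0 : S)))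
      (𝓝[>] 0) (𝓝 (C 0))
    simp only [map_zero, sub_zero, smul_zero]
    exact tendsto_const_nhds
  smul_mem' := by
    rintro ζ ⟨x, y⟩ h
    let _ := N.topology
    have h1 : Tendsto (fun s : ℝ≥0 => constL0 P 𝕜 ((s : ℝ)⁻¹) • (W s x - C x))
      (𝓝[>] 0) (𝓝 (C y)) := h
    change Tendsto (fun s : ℝ≥0 => constL0 P 𝕜 ((s : ℝ)⁻¹) • (W s (ζ • x) - C (ζ • x)))
      (𝓝[>] 0) (𝓝 (C (ζ • y)))
    rw [map_smul C ζ y]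
    refine (N.continuous_const_smul ζ h1).congr fun s => ?_
    rw [map_smul, map_smul, ← smul_sub, smul_comm]

/-- The infinitesimal generator `(A, D(A))` of `W`: `x ∈ D(A)` if and only if the limit of
`(W(s) x - C x) / s` as `s → 0` exists and belongs to `R(C)`, and then `A x` is the image of this
limit under `C⁻¹`. -/
def generator (N : L0Norm P 𝕜 S) (C : S →ₗ[Ω →ₘ[P] 𝕜] S)
    (W : ℝ≥0 → S →ₗ[Ω →ₘ[P] 𝕜] S) : S →ₗ.[Ω →ₘ[P] 𝕜] S :=
  (N.generatorGraph C W).toLinearPMap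

theorem generator_graph (N : L0Norm P 𝕜 S) {C : S →ₗ[Ω →ₘ[P] 𝕜] S}
    (hC : Function.Injective C) (W : ℝ≥0 → S →ₗ[Ω →ₘ[P] 𝕜] S) :
    (N.generator C W).graph = N.generatorGraph C W := by
  refine Submodule.toLinearPMap_graph_eq _ ?_
  rintro ⟨x, y⟩ h hx
  let _ := N.topology
  have _ := N.t2Space
  obtain rfl : x = 0 := hx
  have h1 : Tendsto (fun s : ℝ≥0 => constL0 P 𝕜 ((s : ℝ)⁻¹) • (W s (0 : S) - C (0 : S)))
    (𝓝[>] 0) (𝓝 (C y)) := h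
  simp only [map_zero, sub_zero, smul_zero] at h1
  have h2 : C y = 0 := tendsto_nhds_unique h1 tendsto_const_nhds
  exact hC (by rw [h2, map_zero])

theorem mem_generator_iff (N : L0Norm P 𝕜 S) {C : S →ₗ[Ω →ₘ[P] 𝕜] S}
    (hC : Function.Injective C) (W : ℝ≥0 → S →ₗ[Ω →ₘ[P] 𝕜] S) (x y : S) :
    (∃ hx : x ∈ (N.generator C W).domain, N.generator C W ⟨x, hx⟩ = y) ↔
      Tendsto (fun s : ℝ≥0 => constL0 P 𝕜 ((s : ℝ)⁻¹) • (W s x - C x))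
        (𝓝[>] 0) (@nhds S N.topology (C y)) := by
  have h : (x, y) ∈ (N.generator C W).graph ↔ (x, y) ∈ N.generatorGraph C W := by
    rw [N.generator_graph hC W]
  rw [LinearPMap.mem_graph_iff] at h
  refine Iff.trans ⟨?_, ?_⟩ h
  · rintro ⟨hx, hy⟩
    exact ⟨⟨x, hx⟩, rfl, hy⟩
  · rintro ⟨⟨x', hx⟩, rfl, hy⟩
    exact ⟨hx, hy⟩

/-- `[D(A)]`: the module `D(A)` with the graph `L⁰`-norm `‖x‖ + ‖A x‖`. -/
def graphNorm (N : L0Norm P 𝕜 S) (A : S →ₗ.[Ω →ₘ[P] 𝕜] S) : L0Norm P 𝕜 A.domain where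
  nrm x := N.nrm x + N.nrm (A x)
  nonneg x := by
    rw [← AEEqFun.coeFn_le]
    filter_upwards [N.nonneg_ae x, N.nonneg_ae (A x), AEEqFun.coeFn_add (N.nrm x) (N.nrm (A x)),
      (AEEqFun.coeFn_zero : ⇑(0 : Ω →ₘ[P] ℝ) =ᵐ[P] 0)] with ω h1 h2 h3 h4
    rw [h3, h4]
    exact add_nonneg h1 h2
  eq_zero_of_nrm_eq_zero x h := by
    refine Subtype.ext (N.eq_zero_of_nrm_eq_zero _ (AEEqFun.ext ?_))
    have h' : ⇑(N.nrm x + N.nrm (A x)) =ᵐ[P] ⇑(0 : Ω →ₘ[P] ℝ) := by rw [h]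
    filter_upwards [N.nonneg_ae x, N.nonneg_ae (A x), AEEqFun.coeFn_add (N.nrm x) (N.nrm (A x)),
      (AEEqFun.coeFn_zero : ⇑(0 : Ω →ₘ[P] ℝ) =ᵐ[P] 0), h'] with ω h1 h2 h3 h4 h5
    rw [h3, h4, Pi.add_apply, Pi.zero_apply] at h5
    rw [h4, Pi.zero_apply]
    linarith
  nrm_smul ζ x := by
    rw [A.map_smul, Submodule.coe_smul, N.nrm_smul, N.nrm_smul, mul_add]
  nrm_add_le x y := by
    rw [A.map_add, Submodule.coe_add, ← AEEqFun.coeFn_le]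
    filter_upwards [N.nrm_add_ae x y, N.nrm_add_ae (A x) (A y),
      AEEqFun.coeFn_add (N.nrm (x + y)) (N.nrm (A x + A y)),
      AEEqFun.coeFn_add (N.nrm x + N.nrm (A x)) (N.nrm y + N.nrm (A y)),
      AEEqFun.coeFn_add (N.nrm x) (N.nrm (A x)),
      AEEqFun.coeFn_add (N.nrm y) (N.nrm (A y))] with ω h1 h2 h3 h4 h5 h6
    rw [h3, h4, Pi.add_apply, Pi.add_apply, h5, h6, Pi.add_apply, Pi.add_apply]
    linarith

/-- `g : [0, ∞) → S` has the `T_{ε,λ}`-derivative `d` at `t` (one-sided at `t = 0`). -/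
def HasDeriv (N : L0Norm P 𝕜 S) (g : ℝ≥0 → S) (d : S) (t : ℝ≥0) : Prop :=
  Tendsto (fun s : ℝ≥0 => constL0 P 𝕜 (((s : ℝ) - t)⁻¹) • (g s - g t)) (𝓝[≠] t)
    (@nhds S N.topology d)

/-- `g ∈ C¹([0, ∞), S)`. -/
def IsC1 (N : L0Norm P 𝕜 S) (g : ℝ≥0 → S) : Prop :=
  ∃ g' : ℝ≥0 → S, @Continuous ℝ≥0 S _ N.topology g' ∧ ∀ t, N.HasDeriv g (g' t) t

/-- `g : [0, ∞) → S` is locally `L⁰`-Lipschitz. -/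
def LocallyL0Lipschitz (N : L0Norm P 𝕜 S) (g : ℝ≥0 → S) : Prop :=
  ∀ L : ℝ≥0, 0 < L → ∃ ζ : Ω →ₘ[P] ℝ, 0 ≤ ζ ∧
    ∀ s₁ s₂ : ℝ≥0, s₁ ≤ L → s₂ ≤ L → N.nrm (g s₁ - g s₂) ≤ |(s₁ : ℝ) - s₂| • ζ

/-- `u ∈ C([0, ∞), [D(A)]) ∩ C¹([0, ∞), S)` is a solution of the abstract Cauchy problem
`u'(t) = A u(t)` for `t > 0`, `u(0) = u₀`. -/
structure IsSolution (N : L0Norm P 𝕜 S) (A : S →ₗ.[Ω →ₘ[P] 𝕜] S) (u₀ : S) (u : ℝ≥0 → S) :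
    Prop where
  mem_domain : ∀ t, u t ∈ A.domain
  continuous : @Continuous ℝ≥0 A.domain _ (N.graphNorm A).topology fun t => ⟨u t, mem_domain t⟩
  isC1 : N.IsC1 u
  deriv_eq : ∀ t, 0 < t → N.HasDeriv u (A ⟨u t, mem_domain t⟩) t
  initial : u 0 = u₀

end L0Norm

section Resolvent

variable {R : Type*} [CommRing R] {S : Type*} [AddCommGroup S] [Module R S]

/-- The `C`-resolvent set `ρ_C(A)`: `η - A` is injective and `R(C) ⊆ R(η - A)`. -/
def cResolventSet (C : S →ₗ[R] S) (A : S →ₗ.[R] S) : Set R :=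
  {η | Function.Injective (fun x : A.domain => η • (x : S) - A x) ∧
    range C ⊆ range (fun x : A.domain => η • (x : S) - A x)}

/-- The `C`-resolvent `R_C(η, A) = (η - A)⁻¹ C`, for `η ∈ ρ_C(A)`. -/
def cResolvent {C : S →ₗ[R] S} {A : S →ₗ.[R] S} {η : R} (hη : η ∈ cResolventSet C A) (y : S) : S :=
  ((hη.2 (mem_range_self y)).choose : A.domain)

theorem cResolvent_eq_iff {C : S →ₗ[R] S} {A : S →ₗ.[R] S} {η : R} (hη : η ∈ cResolventSet C A)
    (x y : S) : cResolvent hη y = x ↔ ∃ hx : x ∈ A.domain, η • x - A ⟨x, hx⟩ = C y := by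
  have hspec := (hη.2 (mem_range_self y)).choose_spec
  constructor
  · rintro rfl
    exact ⟨Subtype.property _, hspec⟩
  · rintro ⟨hx, h⟩
    exact congrArg Subtype.val (hη.1 (a₂ := ⟨x, hx⟩) (hspec.trans h.symm))

end Resolvent

end RandomModule

end

/-! Formally $C^{-1}W(t)\int_0^\infty e^{-\eta s}W(s)z\,ds = e^{\eta t}\int_t^\infty e^{-\eta
s}W(s)z\,ds$, because $W(t)W(s)=CW(t+s)$. The right side involves no $C^{-1}$ and serves as the
definition of maps $E(t)$, with $E(0)=R_C(\eta,A)$ and $u(t)=E(t)y$ when $u_0=E(0)y$.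
Differentiation gives $E'(t)z=\eta E(t)z-W(t)z$. Together with $CE(t)=W(t)E(0)$ this shows
$AE(t)z=E'(t)z$ (`mem_generator_of_hasDeriv`); at $t=0$ it reads $(\eta-A)E(0)=C$. Conversely
$E(0)(\eta-A)x=Cx$ on $D(A)$ (`zero_sub_generator`), so $\eta-A$ is injective.

The integral is taken in a Banach space. If the integrand is dominated by a random variable $g$, it
lives in the space of $x$ with $E[\|x\|/(1+|g|)]<\infty$, which is complete because $S$ is. Under
this domination, convergence in probability and convergence in the weighted norm agree
(`conv_of_tendsto`, `tendsto_of_conv`), so Bochner integration and real calculus apply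
(`exists_tail`). Domination comes from $\eta>\xi$: $e^{-(\eta-\xi)s}$ is at most $(1+s^2)^{-1}$
times a random variable.

A function with zero derivative in probability need not be constant ($s\mapsto 1_{[0,s]}$ in
$L^0[0,1]$), but an $L^0$-Lipschitz one is (`eq_of_hasDeriv_zero`), since its difference quotients
are dominated. This fact is used twice. It characterises the tail integrals by their derivative,
Lipschitz bound and limit at infinity, which yields every algebraic identity for $E$. It also gives
uniqueness: for a Lipschitz solution $v$, the function $s\mapsto E(t-s)v(s)$ has zero derivative, so
$E(0)v(t)=E(t)u_0$, whence $Cv(t)=W(t)u_0$. -/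

namespace RandomModule

/-! ### Real constants and exponentials as random scalars. -/

section Scalars

variable {Ω : Type*} [MeasurableSpace Ω] {P : Measure Ω} {𝕜 : Type*} [RCLike 𝕜]

theorem constL0_ae (r : ℝ) : ∀ᵐ ω ∂P, constL0 P 𝕜 r ω = (r : 𝕜) :=
  AEEqFun.coeFn_const Ω (r : 𝕜)

theorem ofRealL0_ae (a : Ω →ₘ[P] ℝ) : ∀ᵐ ω ∂P, ofRealL0 𝕜 a ω = (a ω : 𝕜) :=
  AEEqFun.coeFn_comp _ _ a

theorem expL0_ae (a : Ω →ₘ[P] ℝ) (s : ℝ) : ∀ᵐ ω ∂P, expL0 a s ω = Real.exp (a ω * s) :=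
  AEEqFun.coeFn_comp _ _ a

theorem constL0_zero : constL0 P 𝕜 0 = 0 := by
  unfold constL0; rw [RCLike.ofReal_zero]; rfl

theorem constL0_one : constL0 P 𝕜 1 = 1 := by
  unfold constL0; rw [RCLike.ofReal_one]; rfl

theorem constL0_add (r s : ℝ) : constL0 P 𝕜 (r + s) = constL0 P 𝕜 r + constL0 P 𝕜 s := by
  apply AEEqFun.ext
  filter_upwards [constL0_ae (P := P) (𝕜 := 𝕜) (r + s), constL0_ae (P := P) (𝕜 := 𝕜) r,
    constL0_ae (P := P) (𝕜 := 𝕜) s,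
    AEEqFun.coeFn_add (constL0 P 𝕜 r) (constL0 P 𝕜 s)] with ω h1 h2 h3 h4
  rw [h1, h4, Pi.add_apply, h2, h3, RCLike.ofReal_add]

theorem constL0_mul (r s : ℝ) : constL0 P 𝕜 (r * s) = constL0 P 𝕜 r * constL0 P 𝕜 s := by
  apply AEEqFun.ext
  filter_upwards [constL0_ae (P := P) (𝕜 := 𝕜) (r * s), constL0_ae (P := P) (𝕜 := 𝕜) r,
    constL0_ae (P := P) (𝕜 := 𝕜) s,
    AEEqFun.coeFn_mul (constL0 P 𝕜 r) (constL0 P 𝕜 s)] with ω h1 h2 h3 h4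
  rw [h1, h4, Pi.mul_apply, h2, h3, RCLike.ofReal_mul]

theorem constL0_neg (r : ℝ) : constL0 P 𝕜 (-r) = -constL0 P 𝕜 r := by
  rw [eq_neg_iff_add_eq_zero, ← constL0_add, neg_add_cancel, constL0_zero]

/-- `e^{η s}`, as an element of `L⁰(F, 𝕜)`. -/
noncomputable def expK (𝕜 : Type*) [RCLike 𝕜] (η : Ω →ₘ[P] ℝ) (s : ℝ) : Ω →ₘ[P] 𝕜 :=
  ofRealL0 𝕜 (expL0 η s)

theorem expK_ae (η : Ω →ₘ[P] ℝ) (s : ℝ) :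
    ∀ᵐ ω ∂P, expK 𝕜 η s ω = ((Real.exp (η ω * s) : ℝ) : 𝕜) := by
  filter_upwards [ofRealL0_ae (𝕜 := 𝕜) (expL0 η s), expL0_ae η s] with ω h1 h2
  rw [expK, h1, h2]

theorem expK_zero (η : Ω →ₘ[P] ℝ) : expK 𝕜 η 0 = 1 := by
  apply AEEqFun.ext
  filter_upwards [expK_ae (𝕜 := 𝕜) η 0, (AEEqFun.coeFn_one : ⇑(1 : Ω →ₘ[P] 𝕜) =ᵐ[P] 1)]
    with ω h1 h2
  rw [h1, h2]; simp

theorem expK_add (η : Ω →ₘ[P] ℝ) (r s : ℝ) : expK 𝕜 η (r + s) = expK 𝕜 η r * expK 𝕜 η s := by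
  apply AEEqFun.ext
  filter_upwards [expK_ae (𝕜 := 𝕜) η (r + s), expK_ae (𝕜 := 𝕜) η r, expK_ae (𝕜 := 𝕜) η s,
    AEEqFun.coeFn_mul (expK 𝕜 η r) (expK 𝕜 η s)] with ω h1 h2 h3 h4
  rw [h1, h4, Pi.mul_apply, h2, h3, mul_add, Real.exp_add, RCLike.ofReal_mul]

end Scalars

/-! ### Calculus of convergence to zero in probability, and of the $(\varepsilon,\lambda)$-topology.
-/

section NullInProb

variable {Ω : Type*} [MeasurableSpace Ω] {ι : Type*}

/-- The nonnegative parts of the functions `a i` tend to zero in probability along `l`. -/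
def NullInProb (P : Measure Ω) (l : Filter ι) (a : ι → Ω → ℝ) : Prop :=
  ∀ ε δ : ℝ, 0 < ε → 0 < δ → ∀ᶠ i in l, P.real {ω | ε ≤ a i ω} < δ

variable {P : Measure Ω} {l : Filter ι} {a b : ι → Ω → ℝ}

theorem NullInProb.of_real {r : ι → ℝ} (hr : Tendsto r l (𝓝 0)) :
    NullInProb P l (fun i (_ : Ω) => r i) := by
  intro ε δ hε hδ
  filter_upwards [hr.eventually (gt_mem_nhds hε)] with i hi
  have : {ω : Ω | ε ≤ r i} = ∅ := by
    ext ω; simpa using hi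
  rw [this]; simpa using hδ

variable [IsProbabilityMeasure P]

theorem NullInProb.mono (ha : NullInProb P l a) (h : ∀ᶠ i in l, ∀ᵐ ω ∂P, b i ω ≤ a i ω) :
    NullInProb P l b := by
  intro ε δ hε hδ
  filter_upwards [ha ε δ hε hδ, h] with i h1 h2
  refine lt_of_le_of_lt (ENNReal.toReal_mono (measure_ne_top _ _) (measure_mono_ae ?_)) h1
  filter_upwards [h2] with ω h3 h4
  exact le_trans (show ε ≤ b i ω from h4) h3

theorem NullInProb.add (ha : NullInProb P l a) (hb : NullInProb P l b) :
    NullInProb P l (fun i ω => a i ω + b i ω) := by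
  intro ε δ hε hδ
  filter_upwards [ha (ε / 2) (δ / 2) (by positivity) (by positivity),
    hb (ε / 2) (δ / 2) (by positivity) (by positivity)] with i h1 h2
  have hsub : {ω | ε ≤ a i ω + b i ω} ⊆ {ω | ε / 2 ≤ a i ω} ∪ {ω | ε / 2 ≤ b i ω} := by
    intro ω hω
    have h3 : ε ≤ a i ω + b i ω := hω
    by_contra hcon
    have h4 : ¬ (ε / 2 ≤ a i ω ∨ ε / 2 ≤ b i ω) := hcon
    push Not at h4
    linarith [h4.1, h4.2]
  have h3 := measureReal_mono (μ := P) hsub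
  have h4 := measureReal_union_le (μ := P) {ω | ε / 2 ≤ a i ω} {ω | ε / 2 ≤ b i ω}
  linarith

/-- A random variable is finite everywhere, so the sets where it is at least $K$ decrease to the
empty set. -/
theorem exists_measureReal_le_lt {ζ : Ω → ℝ} (hζ : Measurable ζ) {δ : ℝ} (hδ : 0 < δ) :
    ∃ K : ℕ, P.real {ω | (K : ℝ) ≤ ζ ω} < δ := by
  have ht : Tendsto (fun K : ℕ => P {ω | (K : ℝ) ≤ ζ ω}) atTop
      (𝓝 (P (⋂ K : ℕ, {ω | (K : ℝ) ≤ ζ ω}))) := by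
    refine tendsto_measure_iInter_atTop
      (fun K => (hζ measurableSet_Ici).nullMeasurableSet)
      (fun a b hab ω hω => ?_) ⟨0, measure_ne_top _ _⟩
    have h1 : (b : ℝ) ≤ ζ ω := hω
    have h2 : (a : ℝ) ≤ b := by exact_mod_cast hab
    exact h2.trans h1
  have he : (⋂ K : ℕ, {ω | (K : ℝ) ≤ ζ ω}) = ∅ := by
    ext ω
    simp only [mem_iInter, mem_ofPred_eq, mem_empty_iff_false, iff_false, not_forall, not_le]
    exact exists_nat_gt _
  rw [he, measure_empty] at ht
  have ht' := (ENNReal.tendsto_toReal ENNReal.zero_ne_top).comp ht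
  exact (ht'.eventually (gt_mem_nhds (by simpa using hδ))).exists

theorem NullInProb.const_mul (ha : NullInProb P l a) {ζ : Ω → ℝ} (hζ : Measurable ζ) :
    NullInProb P l (fun i ω => |ζ ω| * a i ω) := by
  intro ε δ hε hδ
  obtain ⟨K, hK⟩ := exists_measureReal_le_lt (P := P) hζ.norm (half_pos hδ)
  have hK1 : (0 : ℝ) < K + 1 := by positivity
  filter_upwards [ha (ε / (K + 1)) (δ / 2) (by positivity) (by positivity)] with i hi
  have hsub : {ω | ε ≤ |ζ ω| * a i ω} ⊆
      {ω | (K : ℝ) ≤ ‖ζ ω‖} ∪ {ω | ε / (K + 1) ≤ a i ω} := by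
    intro ω hω
    have h2 : ε ≤ |ζ ω| * a i ω := hω
    by_contra hcon
    have h3 : ¬ ((K : ℝ) ≤ ‖ζ ω‖ ∨ ε / (K + 1) ≤ a i ω) := hcon
    push Not at h3
    have h5 := (lt_div_iff₀ hK1).1 h3.2
    have h6 := h3.1
    rw [Real.norm_eq_abs] at h6
    rcases le_or_gt (a i ω) 0 with h7 | h7
    · nlinarith [abs_nonneg (ζ ω)]
    · nlinarith [abs_nonneg (ζ ω)]
  have h3 := measureReal_mono (μ := P) hsub
  have h4 := measureReal_union_le (μ := P) {ω | (K : ℝ) ≤ ‖ζ ω‖} {ω | ε / (K + 1) ≤ a i ω}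
  linarith

theorem NullInProb.of_le_mul {r : ι → ℝ} (hr : Tendsto r l (𝓝 0)) {ζ : Ω → ℝ} (hζ : Measurable ζ)
    (h : ∀ᶠ i in l, ∀ᵐ ω ∂P, a i ω ≤ |ζ ω| * r i) : NullInProb P l a :=
  ((NullInProb.of_real hr).const_mul hζ).mono h

end NullInProb

namespace L0Norm

variable {Ω : Type*} [MeasurableSpace Ω] {P : Measure Ω}
  {𝕜 : Type*} [RCLike 𝕜] {S : Type*} [AddCommGroup S] [Module (Ω →ₘ[P] 𝕜) S]

theorem nrm_sub_ae (N : L0Norm P 𝕜 S) (x y : S) :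
    ∀ᵐ ω ∂P, N.nrm (x - y) ω ≤ N.nrm x ω + N.nrm y ω := by
  filter_upwards [N.nrm_add_ae x (-y), N.nrm_neg_ae y] with ω h1 h2
  rw [sub_eq_add_neg]; linarith

theorem nrm_sub_comm_ae (N : L0Norm P 𝕜 S) (x y : S) :
    ∀ᵐ ω ∂P, N.nrm (x - y) ω = N.nrm (y - x) ω := by
  filter_upwards [N.nrm_neg_ae (y - x)] with ω h1
  rw [← neg_sub, h1]

theorem nrm_constL0_smul_ae (N : L0Norm P 𝕜 S) (r : ℝ) (x : S) :
    ∀ᵐ ω ∂P, N.nrm (constL0 P 𝕜 r • x) ω = |r| * N.nrm x ω := by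
  filter_upwards [N.nrm_smul_ae (constL0 P 𝕜 r) x, constL0_ae (P := P) (𝕜 := 𝕜) r] with ω h1 h2
  rw [h1, h2, RCLike.norm_ofReal]

theorem nrm_expK_smul_ae (N : L0Norm P 𝕜 S) (η : Ω →ₘ[P] ℝ) (s : ℝ) (x : S) :
    ∀ᵐ ω ∂P, N.nrm (expK 𝕜 η s • x) ω = Real.exp (η ω * s) * N.nrm x ω := by
  filter_upwards [N.nrm_smul_ae (expK 𝕜 η s) x, expK_ae (𝕜 := 𝕜) η s] with ω h1 h2
  rw [h1, h2, RCLike.norm_ofReal, abs_of_pos (Real.exp_pos _)]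

theorem eq_zero_of_ae (N : L0Norm P 𝕜 S) {x : S} (h : ∀ᵐ ω ∂P, N.nrm x ω ≤ 0) : x = 0 := by
  refine N.eq_zero_of_nrm_eq_zero x (AEEqFun.ext ?_)
  filter_upwards [h, N.nonneg_ae x, (AEEqFun.coeFn_zero : ⇑(0 : Ω →ₘ[P] ℝ) =ᵐ[P] 0)]
    with ω h1 h2 h3
  rw [h3]; exact le_antisymm h1 h2

/-- Every `T ∈ B(S)` has a measurable bound. -/
theorem ASBounded.exists_bound {N : L0Norm P 𝕜 S} {T : S →ₗ[Ω →ₘ[P] 𝕜] S} (hT : N.ASBounded T) :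
    ∃ κ : Ω → ℝ, Measurable κ ∧ ∀ z, ∀ᵐ ω ∂P, N.nrm (T z) ω ≤ |κ ω| * N.nrm z ω := by
  obtain ⟨κ, -, hκ⟩ := hT
  refine ⟨κ, κ.measurable, fun z => ?_⟩
  filter_upwards [le_mul_ae.1 (hκ z), N.nonneg_ae z] with ω h1 h2
  exact h1.trans (mul_le_mul_of_nonneg_right (le_abs_self _) h2)

variable [IsProbabilityMeasure P] {ι : Type*} {l : Filter ι}

/-- Convergence in the `(ε, λ)`-topology. -/
def Conv (N : L0Norm P 𝕜 S) (l : Filter ι) (f : ι → S) (x : S) : Prop :=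
  Tendsto f l (@nhds S N.topology x)

theorem conv_iff {N : L0Norm P 𝕜 S} {f : ι → S} {x : S} :
    N.Conv l f x ↔ NullInProb P l (fun i => N.nrm (f i - x)) :=
  N.tendsto_iff

variable {N : L0Norm P 𝕜 S} {f g : ι → S} {x y : S}

theorem Conv.unique [l.NeBot] (h : N.Conv l f x) (h' : N.Conv l f y) : x = y := by
  let _ := N.topology
  have _ := N.t2Space
  exact tendsto_nhds_unique (show Tendsto f l (𝓝 x) from h) h'

theorem Conv.add (h : N.Conv l f x) (h' : N.Conv l g y) :
    N.Conv l (fun i => f i + g i) (x + y) := by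
  let _ := N.topology
  have _ := N.isTopologicalAddGroup
  exact Filter.Tendsto.add (show Tendsto f l (𝓝 x) from h) h'

theorem Conv.sub (h : N.Conv l f x) (h' : N.Conv l g y) :
    N.Conv l (fun i => f i - g i) (x - y) := by
  let _ := N.topology
  have _ := N.isTopologicalAddGroup
  exact Filter.Tendsto.sub (show Tendsto f l (𝓝 x) from h) h'

theorem Conv.neg (h : N.Conv l f x) : N.Conv l (fun i => -f i) (-x) := by
  let _ := N.topology
  have _ := N.isTopologicalAddGroup
  exact Filter.Tendsto.neg (show Tendsto f l (𝓝 x) from h)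

theorem Conv.const (x : S) : N.Conv l (fun _ => x) x := by
  let _ := N.topology
  exact tendsto_const_nhds

theorem Conv.smul (ζ : Ω →ₘ[P] 𝕜) (h : N.Conv l f x) : N.Conv l (fun i => ζ • f i) (ζ • x) :=
  N.continuous_const_smul ζ h

theorem Conv.congr (h : N.Conv l f x) (hfg : ∀ᶠ i in l, f i = g i) : N.Conv l g x :=
  Filter.Tendsto.congr' hfg h

theorem Conv.comp {κ : Type*} {l' : Filter κ} {φ : κ → ι} (h : N.Conv l f x)
    (hφ : Tendsto φ l' l) : N.Conv l' (fun k => f (φ k)) x :=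
  Filter.Tendsto.comp h hφ

/-- The factor $\kappa$ may be unbounded but must not depend on the index: a fixed random variable
times a null family is null. -/
theorem conv_zero_of_le {κ : Ω → ℝ} (hκ : Measurable κ) (h : N.Conv l f 0)
    (hg : ∀ᶠ i in l, ∀ᵐ ω ∂P, N.nrm (g i) ω ≤ |κ ω| * N.nrm (f i) ω) : N.Conv l g 0 := by
  rw [conv_iff] at h ⊢
  simp only [sub_zero] at h ⊢
  exact (h.const_mul hκ).mono hg

theorem conv_zero_of_le_real {κ : Ω → ℝ} (hκ : Measurable κ) {r : ι → ℝ} (hr : Tendsto r l (𝓝 0))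
    (hg : ∀ᶠ i in l, ∀ᵐ ω ∂P, N.nrm (g i) ω ≤ |κ ω| * r i) : N.Conv l g 0 := by
  rw [conv_iff]
  simp only [sub_zero]
  exact NullInProb.of_le_mul hr hκ hg

theorem conv_sub_iff : N.Conv l (fun i => f i - x) 0 ↔ N.Conv l f x := by
  rw [conv_iff, conv_iff]
  simp only [sub_zero]

theorem Conv.map {T : S →ₗ[Ω →ₘ[P] 𝕜] S} (hT : N.ASBounded T) (h : N.Conv l f x) :
    N.Conv l (fun i => T (f i)) (T x) := by
  obtain ⟨κ, hκ, hb⟩ := hT.exists_bound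
  rw [← conv_sub_iff] at h ⊢
  refine conv_zero_of_le hκ h (Eventually.of_forall fun i => ?_)
  rw [← map_sub]
  exact hb _

theorem continuous_iff {T : Type*} [TopologicalSpace T] {f : T → S} :
    @Continuous T S _ N.topology f ↔ ∀ t, N.Conv (𝓝 t) f (f t) := by
  let _ := N.topology
  exact continuous_iff_continuousAt

end L0Norm

end RandomModule

namespace RandomModule

/-! ### The Banach space of elements with integrable weighted norm. -/

section Weight

variable {Ω : Type*} [MeasurableSpace Ω] {P : Measure Ω} (g : Ω →ₘ[P] ℝ)

/-- The weight `(1 + |g|)⁻¹`. -/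
noncomputable def wt (ω : Ω) : ℝ := (1 + |g ω|)⁻¹

theorem wt_pos (ω : Ω) : 0 < wt g ω := by unfold wt; positivity

theorem wt_le_one (ω : Ω) : wt g ω ≤ 1 := by
  unfold wt
  exact inv_le_one_of_one_le₀ (by linarith [abs_nonneg (g ω)])

theorem wt_mul_abs_le_one (ω : Ω) : wt g ω * |g ω| ≤ 1 := by
  unfold wt
  rw [inv_mul_le_iff₀ (by positivity)]
  linarith

theorem measurable_wt : Measurable (wt g) :=
  (measurable_const.add g.measurable.norm).inv

end Weight

namespace L0Norm

variable {Ω : Type*} [MeasurableSpace Ω] {P : Measure Ω}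
  {𝕜 : Type*} [RCLike 𝕜] {S : Type*} [AddCommGroup S] [Module (Ω →ₘ[P] 𝕜) S]

theorem integrable_wt_of_le (N : L0Norm P 𝕜 S) (g : Ω →ₘ[P] ℝ) {x : S} {φ : Ω → ℝ}
    (hφ : Integrable φ P) (h : ∀ᵐ ω ∂P, wt g ω * N.nrm x ω ≤ φ ω) :
    Integrable (fun ω => wt g ω * N.nrm x ω) P := by
  refine hφ.mono' ((measurable_wt g).mul (N.nrm x).measurable).aestronglyMeasurable ?_
  filter_upwards [h, N.nonneg_ae x] with ω h1 h2
  rwa [Real.norm_of_nonneg (mul_nonneg (wt_pos g ω).le h2)]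

/-- The elements of `S` whose `L⁰`-norm is integrable with respect to the weight `wt g`. -/
def weightedSubgroup (N : L0Norm P 𝕜 S) (g : Ω →ₘ[P] ℝ) : AddSubgroup S where
  carrier := {x | Integrable (fun ω => wt g ω * N.nrm x ω) P}
  zero_mem' := N.integrable_wt_of_le g (integrable_zero _ _ _) (by
    filter_upwards [N.nrm_zero_ae] with ω h
    rw [h, mul_zero, Pi.zero_apply])
  add_mem' {x y} hx hy := N.integrable_wt_of_le g (Integrable.add hx hy) (by
    filter_upwards [N.nrm_add_ae x y] with ω h
    rw [Pi.add_apply, ← mul_add]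
    exact mul_le_mul_of_nonneg_left h (wt_pos g ω).le)
  neg_mem' {x} hx := N.integrable_wt_of_le g hx (by
    filter_upwards [N.nrm_neg_ae x] with ω h
    rw [h])

/-- The space of all `x` in `S` with `E[wt g * ‖x‖] < ∞`. -/
def WeightedL1 (N : L0Norm P 𝕜 S) (g : Ω →ₘ[P] ℝ) : Type _ := N.weightedSubgroup g

namespace WeightedL1

variable {N : L0Norm P 𝕜 S} {g : Ω →ₘ[P] ℝ}

instance : AddCommGroup (N.WeightedL1 g) := inferInstanceAs (AddCommGroup (N.weightedSubgroup g))

/-- The underlying element of `S`. -/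
def val (x : N.WeightedL1 g) : S := Subtype.val (p := (· ∈ N.weightedSubgroup g)) x

theorem integrable (x : N.WeightedL1 g) : Integrable (fun ω => wt g ω * N.nrm x.val ω) P :=
  Subtype.property (p := (· ∈ N.weightedSubgroup g)) x

/-- An element of `S` with integrable weighted norm. -/
def mk (x : S) (hx : Integrable (fun ω => wt g ω * N.nrm x ω) P) : N.WeightedL1 g :=
  Subtype.mk (p := (· ∈ N.weightedSubgroup g)) x hx

@[simp] theorem val_mk (x : S) (hx : Integrable (fun ω => wt g ω * N.nrm x ω) P) :
    (mk x hx : N.WeightedL1 g).val = x := rfl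

@[ext] theorem ext {x y : N.WeightedL1 g} (h : x.val = y.val) : x = y := Subtype.ext h

@[simp] theorem val_add (x y : N.WeightedL1 g) : (x + y).val = x.val + y.val := rfl
@[simp] theorem val_sub (x y : N.WeightedL1 g) : (x - y).val = x.val - y.val := rfl
@[simp] theorem val_neg (x : N.WeightedL1 g) : (-x).val = -x.val := rfl
@[simp] theorem val_zero : (0 : N.WeightedL1 g).val = 0 := rfl

theorem smul_integrable (ζ : Ω →ₘ[P] 𝕜) (c : ℝ) (hζ : ∀ᵐ ω ∂P, ‖ζ ω‖ ≤ c) (x : N.WeightedL1 g) :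
    Integrable (fun ω => wt g ω * N.nrm (ζ • x.val) ω) P := by
  refine N.integrable_wt_of_le g (x.integrable.const_mul c) ?_
  filter_upwards [N.nrm_smul_ae ζ x.val, hζ, N.nonneg_ae x.val] with ω h1 h2 h3
  rw [h1, mul_left_comm]
  exact mul_le_mul_of_nonneg_right h2 (mul_nonneg (wt_pos g ω).le h3)

theorem norm_constL0_le (r : ℝ) : ∀ᵐ ω ∂P, ‖constL0 P 𝕜 r ω‖ ≤ |r| := by
  filter_upwards [constL0_ae (P := P) (𝕜 := 𝕜) r] with ω h
  rw [h, RCLike.norm_ofReal]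

instance : SMul ℝ (N.WeightedL1 g) :=
  ⟨fun r x => mk (constL0 P 𝕜 r • x.val) (smul_integrable _ |r| (norm_constL0_le r) x)⟩

@[simp] theorem val_smul (r : ℝ) (x : N.WeightedL1 g) :
    (r • x).val = constL0 P 𝕜 r • x.val := rfl

instance : Module ℝ (N.WeightedL1 g) where
  one_smul x := by ext; rw [val_smul, constL0_one, one_smul]
  mul_smul r s x := by ext; rw [val_smul, val_smul, val_smul, constL0_mul, mul_smul]
  smul_zero r := by ext; rw [val_smul, val_zero, smul_zero]
  smul_add r x y := by ext; rw [val_smul, val_add, val_add, val_smul, val_smul, smul_add]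
  add_smul r s x := by ext; rw [val_smul, val_add, val_smul, val_smul, constL0_add, add_smul]
  zero_smul x := by ext; rw [val_smul, constL0_zero, zero_smul, val_zero]

noncomputable instance : Norm (N.WeightedL1 g) := ⟨fun x => ∫ ω, wt g ω * N.nrm x.val ω ∂P⟩

theorem norm_def (x : N.WeightedL1 g) : ‖x‖ = ∫ ω, wt g ω * N.nrm x.val ω ∂P := rfl

theorem wt_nrm_nonneg (x : N.WeightedL1 g) : 0 ≤ᵐ[P] fun ω => wt g ω * N.nrm x.val ω := by
  filter_upwards [N.nonneg_ae x.val] with ω h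
  exact mul_nonneg (wt_pos g ω).le h

theorem core : NormedSpace.Core ℝ (N.WeightedL1 g) where
  norm_nonneg x := integral_nonneg_of_ae x.wt_nrm_nonneg
  norm_smul r x := by
    rw [norm_def, norm_def, ← integral_const_mul]
    refine integral_congr_ae ?_
    filter_upwards [N.nrm_constL0_smul_ae r x.val] with ω h
    rw [val_smul, h, Real.norm_eq_abs]
    ring
  norm_triangle x y := by
    rw [norm_def, norm_def, norm_def, ← integral_add x.integrable y.integrable]
    refine integral_mono_ae (x + y).integrable (x.integrable.add y.integrable) ?_
    filter_upwards [N.nrm_add_ae x.val y.val] with ω h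
    rw [val_add, ← mul_add]
    exact mul_le_mul_of_nonneg_left h (wt_pos g ω).le
  norm_eq_zero_iff x := by
    rw [norm_def, integral_eq_zero_iff_of_nonneg_ae x.wt_nrm_nonneg x.integrable]
    constructor
    · intro h
      ext
      refine N.eq_zero_of_ae ?_
      filter_upwards [h] with ω h1
      have h2 : wt g ω * N.nrm x.val ω = 0 := h1
      exact ((mul_eq_zero.1 h2).resolve_left (wt_pos g ω).ne').le
    · rintro rfl
      filter_upwards [N.nrm_zero_ae] with ω h
      rw [val_zero, h, mul_zero]
      rfl

noncomputable instance : NormedAddCommGroup (N.WeightedL1 g) := NormedAddCommGroup.ofCore core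

noncomputable instance : NormedSpace ℝ (N.WeightedL1 g) := NormedSpace.ofCore core

theorem norm_le_of_ae {x : N.WeightedL1 g} {φ : Ω → ℝ} (hφ : Integrable φ P)
    (h : ∀ᵐ ω ∂P, wt g ω * N.nrm x.val ω ≤ φ ω) : ‖x‖ ≤ ∫ ω, φ ω ∂P :=
  integral_mono_ae x.integrable hφ h

/-- Fatou's lemma for the weighted norms. Integrability of $z$ is a conclusion, so the lemma also
shows that a limit found in $S$ belongs to the weighted space. -/
theorem integrable_and_integral_le_of_fatou {y : ℕ → N.WeightedL1 g} {z : S} {ε : ℝ}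
    (hy : ∀ᶠ k in atTop, ‖y k‖ ≤ ε)
    (h : ∀ᵐ ω ∂P, Tendsto (fun k => N.nrm (y k).val ω) atTop (𝓝 (N.nrm z ω))) :
    Integrable (fun ω => wt g ω * N.nrm z ω) P ∧ ∫ ω, wt g ω * N.nrm z ω ∂P ≤ ε := by
  have hm : ∀ z : S, Measurable (fun ω => wt g ω * N.nrm z ω) :=
    fun z => (measurable_wt g).mul (N.nrm z).measurable
  have hε : 0 ≤ ε := by
    obtain ⟨k, hk⟩ := hy.exists
    exact (norm_nonneg _).trans hk
  have hz : 0 ≤ᵐ[P] fun ω => wt g ω * N.nrm z ω := by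
    filter_upwards [N.nonneg_ae z] with ω h
    exact mul_nonneg (wt_pos g ω).le h
  have hle : ∫⁻ ω, ENNReal.ofReal (wt g ω * N.nrm z ω) ∂P ≤ ENNReal.ofReal ε := by
    calc ∫⁻ ω, ENNReal.ofReal (wt g ω * N.nrm z ω) ∂P
        = ∫⁻ ω, liminf (fun k => ENNReal.ofReal (wt g ω * N.nrm (y k).val ω)) atTop ∂P := by
          refine lintegral_congr_ae ?_
          filter_upwards [h] with ω h1
          exact (ENNReal.tendsto_ofReal (h1.const_mul (wt g ω))).liminf_eq.symm
      _ ≤ liminf (fun k => ∫⁻ ω, ENNReal.ofReal (wt g ω * N.nrm (y k).val ω) ∂P) atTop :=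
          lintegral_liminf_le fun k => (hm _).ennreal_ofReal
      _ ≤ ENNReal.ofReal ε := by
          refine liminf_le_of_frequently_le' (Eventually.frequently ?_)
          filter_upwards [hy] with k hk
          rw [← ofReal_integral_eq_lintegral_ofReal (y k).integrable (y k).wt_nrm_nonneg]
          exact ENNReal.ofReal_le_ofReal hk
  have hint : Integrable (fun ω => wt g ω * N.nrm z ω) P := by
    refine ⟨(hm z).aestronglyMeasurable, ?_⟩
    rw [hasFiniteIntegral_iff_ofReal hz]
    exact hle.trans_lt ENNReal.ofReal_lt_top
  refine ⟨hint, ?_⟩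
  rw [← ofReal_integral_eq_lintegral_ofReal hint hz] at hle
  exact (ENNReal.ofReal_le_ofReal_iff hε).1 hle

variable [IsProbabilityMeasure P] {ι : Type*} {l : Filter ι}

/-- The weight is chosen so that its product with $|g|$ is at most $1$; random bounds by $|g|$ thus
become real norm bounds. -/
theorem norm_le_of_nrm_le {x : N.WeightedL1 g} {c : ℝ}
    (h : ∀ᵐ ω ∂P, N.nrm x.val ω ≤ c * |g ω|) (hc : 0 ≤ c) : ‖x‖ ≤ c := by
  refine (norm_le_of_ae (integrable_const c) ?_).trans (by simp)
  filter_upwards [h] with ω h1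
  have := wt_mul_abs_le_one g ω
  have := wt_pos g ω
  calc wt g ω * N.nrm x.val ω ≤ wt g ω * (c * |g ω|) := by gcongr
    _ = c * (wt g ω * |g ω|) := by ring
    _ ≤ c * 1 := by gcongr
    _ = c := mul_one c

/-- An element of `S` whose `L⁰`-norm is at most a multiple of `|g|`. -/
def ofLE (x : S) (c : ℝ) (h : ∀ᵐ ω ∂P, N.nrm x ω ≤ c * |g ω|) : N.WeightedL1 g :=
  mk x (by
    refine N.integrable_wt_of_le g (integrable_const |c|) ?_
    filter_upwards [h] with ω h1
    have := wt_mul_abs_le_one g ω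
    have := wt_pos g ω
    calc wt g ω * N.nrm x ω ≤ wt g ω * (|c| * |g ω|) := by
          gcongr
          exact h1.trans (mul_le_mul_of_nonneg_right (le_abs_self c) (abs_nonneg _))
      _ = |c| * (wt g ω * |g ω|) := by ring
      _ ≤ |c| * 1 := by gcongr
      _ = |c| := mul_one _)

@[simp] theorem val_ofLE (x : S) (c : ℝ) (h : ∀ᵐ ω ∂P, N.nrm x ω ≤ c * |g ω|) :
    (ofLE x c h : N.WeightedL1 g).val = x := rfl

/-- Convergence in the weighted norm implies convergence in probability. -/
theorem nullInProb {x : ι → N.WeightedL1 g} (h : Tendsto (fun i => ‖x i‖) l (𝓝 0)) :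
    NullInProb P l (fun i => N.nrm (x i).val) := by
  have h1 : NullInProb P l (fun i ω => wt g ω * N.nrm (x i).val ω) := by
    intro ε δ hε hδ
    filter_upwards [h.eventually (gt_mem_nhds (mul_pos hε hδ))] with i hi
    have h2 := mul_meas_ge_le_integral_of_nonneg (x i).wt_nrm_nonneg (x i).integrable ε
    exact lt_of_mul_lt_mul_left (h2.trans_lt hi) hε.le
  -- The weight is removed by multiplying with its inverse, a finite random variable.
  refine (h1.const_mul (measurable_wt g).inv).mono (Eventually.of_forall fun i => ?_)
  refine Eventually.of_forall fun ω => le_of_eq ?_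
  have := wt_pos g ω
  rw [Pi.inv_apply, abs_of_pos (inv_pos.2 this), inv_mul_cancel_left₀ this.ne']

theorem conv_of_tendsto {x : ι → N.WeightedL1 g} {y : N.WeightedL1 g} (h : Tendsto x l (𝓝 y)) :
    N.Conv l (fun i => (x i).val) y.val := by
  rw [conv_iff]
  exact nullInProb (x := fun i => x i - y) (tendsto_iff_norm_sub_tendsto_zero.1 h)

/-- Bounded convergence. -/
theorem tendsto_norm_of_nullInProb {x : ι → N.WeightedL1 g} {c : ℝ} (hc : 0 ≤ c)
    (hb : ∀ᶠ i in l, ∀ᵐ ω ∂P, N.nrm (x i).val ω ≤ c * |g ω|)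
    (h : NullInProb P l (fun i => N.nrm (x i).val)) : Tendsto (fun i => ‖x i‖) l (𝓝 0) := by
  rw [Metric.tendsto_nhds]
  intro ε hε
  -- The exceptional set $s$, where the weighted norm is only known to be at most $c$, contributes
  -- less than $\varepsilon/2$; off $s$ the weight is at most $1$ and the contribution is at most
  -- $\varepsilon/2$. The denominator $c+1$ allows $c=0$.
  filter_upwards [hb, h (ε / 2) (ε / 2 / (c + 1)) (by positivity) (by positivity)] with i h1 h2
  rw [Real.dist_0_eq_abs, abs_of_nonneg (norm_nonneg _)]
  set s : Set Ω := {ω | ε / 2 ≤ N.nrm (x i).val ω} with hs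
  have hsm : MeasurableSet s := (N.nrm (x i).val).measurable measurableSet_Ici
  have hint : Integrable (fun ω => ε / 2 + s.indicator (fun _ => c) ω) P :=
    (integrable_const _).add ((integrable_const c).indicator hsm)
  have h3 : ‖x i‖ ≤ ∫ ω, (ε / 2 + s.indicator (fun _ => c) ω) ∂P := by
    refine norm_le_of_ae hint ?_
    filter_upwards [h1, N.nonneg_ae (x i).val] with ω h4 h5
    have h6 := wt_mul_abs_le_one g ω
    have h7 := wt_pos g ω
    by_cases hω : ω ∈ s
    · rw [indicator_of_mem hω]
      have : wt g ω * N.nrm (x i).val ω ≤ c := by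
        calc wt g ω * N.nrm (x i).val ω ≤ wt g ω * (c * |g ω|) := by gcongr
          _ = c * (wt g ω * |g ω|) := by ring
          _ ≤ c * 1 := by gcongr
          _ = c := mul_one c
      linarith
    · rw [indicator_of_notMem hω, add_zero]
      have h8 : N.nrm (x i).val ω < ε / 2 := not_le.1 hω
      have h9 := wt_le_one g ω
      nlinarith
  rw [integral_add (integrable_const _) ((integrable_const c).indicator hsm),
    integral_indicator_const c hsm] at h3
  simp only [integral_const, probReal_univ, smul_eq_mul] at h3
  have h10 : P.real s * c < ε / 2 := by
    have h11 : P.real s * (c + 1) < ε / 2 := (lt_div_iff₀ (by positivity)).1 h2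
    nlinarith [measureReal_nonneg (μ := P) (s := s)]
  linarith

/-- The converse of `conv_of_tendsto` under domination. It lifts continuity and differentiability in
probability to the Banach space. -/
theorem tendsto_of_conv {x : ι → N.WeightedL1 g} {y : N.WeightedL1 g} {c : ℝ} (hc : 0 ≤ c)
    (hb : ∀ᶠ i in l, ∀ᵐ ω ∂P, N.nrm ((x i).val - y.val) ω ≤ c * |g ω|)
    (h : N.Conv l (fun i => (x i).val) y.val) : Tendsto x l (𝓝 y) := by
  rw [tendsto_iff_norm_sub_tendsto_zero]
  exact tendsto_norm_of_nullInProb (x := fun i => x i - y) hc hb (conv_iff.1 h)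

theorem exists_subseq_nrm_tendsto {f : ℕ → S} {x : S} (hx : N.Conv atTop f x) :
    ∃ ns : ℕ → ℕ, StrictMono ns ∧
      ∀ᵐ ω ∂P, Tendsto (fun k => N.nrm (f (ns k) - x) ω) atTop (𝓝 0) := by
  have h : TendstoInMeasure P (fun n => ⇑(N.nrm (f n - x))) atTop (fun _ => (0 : ℝ)) := by
    rw [tendstoInMeasure_iff_measureReal_norm]
    intro ε hε
    rw [Metric.tendsto_nhds]
    intro δ hδ
    filter_upwards [conv_iff.1 hx ε δ hε hδ] with n hn
    rw [Real.dist_0_eq_abs, abs_of_nonneg measureReal_nonneg]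
    refine lt_of_le_of_lt (ENNReal.toReal_mono (measure_ne_top _ _) (measure_mono_ae ?_)) hn
    filter_upwards [N.nonneg_ae (f n - x)] with ω h1 h2
    have h3 : ε ≤ ‖N.nrm (f n - x) ω - 0‖ := h2
    rw [sub_zero, Real.norm_of_nonneg h1] at h3
    exact h3
  exact h.exists_seq_tendsto_ae

/-- A Cauchy sequence in the weighted norm is Cauchy in probability, hence converges in $S$; along
an almost surely convergent subsequence, Fatou's lemma turns the Cauchy estimates into estimates for
the distance to the limit. -/
theorem completeSpace (hN : N.IsComplete) : CompleteSpace (N.WeightedL1 g) := by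
  refine Metric.complete_of_cauchySeq_tendsto fun u hu => ?_
  have hu2 : Tendsto (fun p : ℕ × ℕ => ‖u p.2 - u p.1‖) (atTop ×ˢ atTop) (𝓝 0) := by
    have h := (cauchySeq_iff_tendsto_dist_atTop_0.1 hu)
    rw [prod_atTop_atTop_eq]
    refine h.congr fun p => ?_
    rw [dist_comm, dist_eq_norm]
  have hu3 := nullInProb (x := fun p : ℕ × ℕ => u p.2 - u p.1) hu2
  have hconv : ∃ x : S, N.Conv atTop (fun n => (u n).val) x := by
    let _ := N.uniformSpace
    have _ : CompleteSpace S := hN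
    refine cauchySeq_tendsto_of_complete (u := fun n => (u n).val) ?_
    unfold CauchySeq Cauchy
    refine ⟨inferInstance, ?_⟩
    rw [prod_map_map_eq, uniformity_eq_comap_nhds_zero' S, ← map_le_iff_le_comap, map_map]
    have h := conv_iff.2 (show NullInProb P (atTop ×ˢ atTop)
      fun p : ℕ × ℕ => N.nrm (((u p.2).val - (u p.1).val) - 0) by simpa using hu3)
    refine le_trans (le_of_eq ?_) h
    congr 1
    funext p
    simp [sub_eq_add_neg]
  obtain ⟨x, hx⟩ := hconv
  obtain ⟨ns, hns, hae⟩ := exists_subseq_nrm_tendsto hx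
  have key : ∀ ε : ℝ, 0 < ε → ∀ᶠ n in atTop,
      Integrable (fun ω => wt g ω * N.nrm ((u n).val - x) ω) P ∧
        ∫ ω, wt g ω * N.nrm ((u n).val - x) ω ∂P ≤ ε := by
    intro ε hε
    obtain ⟨n₀, hn₀⟩ := Metric.cauchySeq_iff.1 hu ε hε
    filter_upwards [eventually_ge_atTop n₀] with n hn
    refine integrable_and_integral_le_of_fatou (y := fun k => u n - u (ns k)) ?_ ?_
    · filter_upwards [hns.tendsto_atTop.eventually (eventually_ge_atTop n₀)] with k hk
      rw [← dist_eq_norm]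
      exact (hn₀ n hn _ hk).le
    · have h1 : ∀ᵐ ω ∂P, ∀ k, N.nrm ((u n).val - (u (ns k)).val) ω ≤
          N.nrm ((u n).val - x) ω + N.nrm ((u (ns k)).val - x) ω := by
        refine ae_all_iff.2 fun k => ?_
        have := N.nrm_sub_ae ((u n).val - x) ((u (ns k)).val - x)
        rwa [sub_sub_sub_cancel_right] at this
      have h2 : ∀ᵐ ω ∂P, ∀ k, N.nrm ((u n).val - x) ω ≤
          N.nrm ((u n).val - (u (ns k)).val) ω + N.nrm ((u (ns k)).val - x) ω := by
        refine ae_all_iff.2 fun k => ?_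
        have := N.nrm_add_ae ((u n).val - (u (ns k)).val) ((u (ns k)).val - x)
        rwa [sub_add_sub_cancel] at this
      filter_upwards [hae, h1, h2] with ω h3 h4 h5
      rw [tendsto_iff_dist_tendsto_zero]
      refine squeeze_zero (fun _ => dist_nonneg) (fun k => ?_) h3
      rw [Real.dist_eq, abs_le, val_sub]
      constructor <;> linarith [h4 k, h5 k]
  obtain ⟨n₁, hn₁, -⟩ := (key 1 one_pos).exists
  -- The limit differs from the member `u n₁` of the subgroup by an element of the subgroup.
  have hxm : x ∈ N.weightedSubgroup g := by
    have := (N.weightedSubgroup g).sub_mem (u n₁).integrable hn₁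
    rwa [sub_sub_cancel] at this
  refine ⟨mk x hxm, Metric.tendsto_nhds.2 fun ε hε => ?_⟩
  filter_upwards [key (ε / 2) (half_pos hε)] with n hn
  rw [dist_eq_norm, norm_def]
  exact hn.2.trans_lt (half_lt_self hε)

end WeightedL1

end L0Norm

end RandomModule

/-! ### Bochner integrals with random bounds, vanishing derivatives, and tail integrals. -/

namespace RandomModule

namespace L0Norm

variable {Ω : Type*} [MeasurableSpace Ω] {P : Measure Ω}
  {𝕜 : Type*} [RCLike 𝕜] {S : Type*} [AddCommGroup S] [Module (Ω →ₘ[P] 𝕜) S]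
  {N : L0Norm P 𝕜 S}

namespace WeightedL1

variable {g : Ω →ₘ[P] ℝ}

/-- The class of the indicator function of `B`. -/
noncomputable def indicatorL0 (P : Measure Ω) (𝕜 : Type*) [RCLike 𝕜] {B : Set Ω}
    (hB : MeasurableSet B) : Ω →ₘ[P] 𝕜 :=
  AEEqFun.mk (B.indicator fun _ => 1) (measurable_const.indicator hB).aestronglyMeasurable

theorem indicatorL0_ae {B : Set Ω} (hB : MeasurableSet B) :
    ∀ᵐ ω ∂P, indicatorL0 P 𝕜 hB ω = B.indicator (fun _ => (1 : 𝕜)) ω :=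
  AEEqFun.coeFn_mk _ _

theorem norm_indicatorL0_le {B : Set Ω} (hB : MeasurableSet B) :
    ∀ᵐ ω ∂P, ‖indicatorL0 P 𝕜 hB ω‖ ≤ 1 := by
  filter_upwards [indicatorL0_ae (P := P) (𝕜 := 𝕜) hB] with ω h
  rw [h]
  by_cases hω : ω ∈ B <;> simp [hω]

/-- Multiplication by an indicator function, as a linear map. -/
noncomputable def restrictₗ (N : L0Norm P 𝕜 S) (g : Ω →ₘ[P] ℝ) {B : Set Ω}
    (hB : MeasurableSet B) : N.WeightedL1 g →ₗ[ℝ] N.WeightedL1 g where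
  toFun x := mk (indicatorL0 P 𝕜 hB • x.val) (smul_integrable _ 1 (norm_indicatorL0_le hB) x)
  map_add' x y := by ext; simp only [val_mk, val_add, smul_add]
  map_smul' r x := by
    ext; simp only [val_mk, val_smul, RingHom.id_apply]; rw [smul_comm]

/-- Localisation to an event recovers almost sure information about $\|x\|$ from the scalar norm. -/
theorem norm_restrictₗ {B : Set Ω} (hB : MeasurableSet B) (x : N.WeightedL1 g) :
    ‖restrictₗ N g hB x‖ = ∫ ω in B, wt g ω * N.nrm x.val ω ∂P := by
  rw [norm_def, ← integral_indicator hB]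
  refine integral_congr_ae ?_
  filter_upwards [N.nrm_smul_ae (indicatorL0 P 𝕜 hB) x.val, indicatorL0_ae (P := P) (𝕜 := 𝕜) hB]
    with ω h1 h2
  change wt g ω * N.nrm (indicatorL0 P 𝕜 hB • x.val) ω = _
  rw [h1, h2]
  by_cases hω : ω ∈ B <;> simp [hω]

/-- Multiplication by an indicator function, as a continuous linear map. -/
noncomputable def restrict (N : L0Norm P 𝕜 S) (g : Ω →ₘ[P] ℝ) {B : Set Ω}
    (hB : MeasurableSet B) : N.WeightedL1 g →L[ℝ] N.WeightedL1 g :=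
  (restrictₗ N g hB).mkContinuous 1 fun x => by
    rw [norm_restrictₗ, one_mul, norm_def]
    exact setIntegral_le_integral x.integrable x.wt_nrm_nonneg

variable [IsProbabilityMeasure P]

theorem integrable_wt_mul_abs : Integrable (fun ω => wt g ω * |g ω|) P := by
  refine (integrable_const (1 : ℝ)).mono'
    ((measurable_wt g).mul g.measurable.norm).aestronglyMeasurable ?_
  refine Eventually.of_forall fun ω => ?_
  rw [Real.norm_of_nonneg (mul_nonneg (wt_pos g ω).le (abs_nonneg _))]
  exact wt_mul_abs_le_one g ω

/-- The triangle inequality for Bochner integrals, for the `L⁰`-norm. -/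
theorem nrm_integral_le [CompleteSpace (N.WeightedL1 g)] {B : Set ℝ} (hB : MeasurableSet B)
    {F : ℝ → N.WeightedL1 g} (hF : IntegrableOn F B) {φ : ℝ → ℝ} (hφ : IntegrableOn φ B)
    (h : ∀ s ∈ B, ∀ᵐ ω ∂P, N.nrm (F s).val ω ≤ φ s * |g ω|) :
    ∀ᵐ ω ∂P, N.nrm (∫ s in B, F s).val ω ≤ (∫ s in B, φ s) * |g ω| := by
  have hle : (fun ω => wt g ω * N.nrm (∫ s in B, F s).val ω) ≤ᵐ[P]
      fun ω => (∫ s in B, φ s) * (wt g ω * |g ω|) := by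
    -- The almost sure inequality is tested on each event $D$. Restriction to $D$ is continuous and
    -- linear, so it commutes with the Bochner integral, and the usual norm inequality applies to
    -- the restricted integrand.
    refine ae_le_of_forall_setIntegral_le (integrable _) (integrable_wt_mul_abs.const_mul _)
      fun D hD _ => ?_
    rw [← norm_restrictₗ hD, integral_const_mul, ← integral_mul_const]
    change ‖restrict N g hD (∫ s in B, F s)‖ ≤ _
    rw [← ContinuousLinearMap.integral_comp_comm _ hF]
    refine norm_integral_le_of_norm_le (hφ.mul_const _) ?_
    refine (ae_restrict_iff' hB).2 (Eventually.of_forall fun s hs => ?_)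
    change ‖restrictₗ N g hD (F s)‖ ≤ _
    rw [norm_restrictₗ, ← integral_const_mul]
    refine integral_mono_ae (F s).integrable.integrableOn
      (integrable_wt_mul_abs.const_mul _).integrableOn (ae_restrict_of_ae ?_)
    filter_upwards [h s hs] with ω h1
    calc wt g ω * N.nrm (F s).val ω ≤ wt g ω * (φ s * |g ω|) :=
          mul_le_mul_of_nonneg_left h1 (wt_pos g ω).le
      _ = φ s * (wt g ω * |g ω|) := by ring
  filter_upwards [hle] with ω h1
  rw [mul_left_comm] at h1
  exact le_of_mul_le_mul_left h1 (wt_pos g ω)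

end WeightedL1

theorem mk_ae {ζ : Ω → ℝ} (hζ : Measurable ζ) :
    ∀ᵐ ω ∂P, (AEEqFun.mk ζ hζ.aestronglyMeasurable : Ω →ₘ[P] ℝ) ω = ζ ω :=
  AEEqFun.coeFn_mk _ _

theorem LocallyL0Lipschitz.exists_bound {v : ℝ≥0 → S} (hv : N.LocallyL0Lipschitz v) (L : ℝ≥0) :
    ∃ ζ : Ω → ℝ, Measurable ζ ∧ ∀ s ≤ L, ∀ t ≤ L,
      ∀ᵐ ω ∂P, N.nrm (v s - v t) ω ≤ |(s : ℝ) - t| * |ζ ω| := by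
  -- The definition provides a constant only for positive lengths, while $L=0$ is allowed here.
  obtain ⟨ζ, -, h⟩ := hv (L + 1) (by positivity)
  refine ⟨ζ, ζ.measurable, fun s hs t ht => ?_⟩
  filter_upwards [AEEqFun.coeFn_le.2 (h s t (hs.trans le_self_add) (ht.trans le_self_add)),
    AEEqFun.coeFn_smul |(s : ℝ) - t| ζ] with ω h1 h2
  rw [h2, Pi.smul_apply, smul_eq_mul] at h1
  exact h1.trans (mul_le_mul_of_nonneg_left (le_abs_self _) (abs_nonneg _))

variable [IsProbabilityMeasure P]

theorem tendsto_toNNReal_nhdsNE {x : ℝ} (hx : 0 ≤ x) :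
    Tendsto Real.toNNReal (𝓝[>] x) (𝓝[≠] x.toNNReal) := by
  refine tendsto_nhdsWithin_iff.2 ⟨(continuous_real_toNNReal.tendsto x).mono_left
    nhdsWithin_le_nhds, ?_⟩
  filter_upwards [self_mem_nhdsWithin] with s hs
  exact ((Real.toNNReal_lt_toNNReal_iff (hx.trans_lt hs)).2 hs).ne'

/-- An `L⁰`-Lipschitz function with vanishing derivative takes the same values at the ends. -/
theorem eq_of_hasDeriv_zero {f : ℝ≥0 → S} {L : ℝ≥0} {ζ : Ω → ℝ} (hζ : Measurable ζ)
    (hlip : ∀ s t : ℝ≥0, s ≤ L → t ≤ L →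
      ∀ᵐ ω ∂P, N.nrm (f s - f t) ω ≤ |(s : ℝ) - t| * |ζ ω|)
    (hd : ∀ t, 0 < t → t < L → N.HasDeriv f 0 t) : f L = f 0 := by
  rcases eq_zero_or_pos L with rfl | hL
  · rfl
  set g : Ω →ₘ[P] ℝ := AEEqFun.mk ζ hζ.aestronglyMeasurable with hg
  have hlip' : ∀ s t : ℝ≥0, s ≤ L → t ≤ L →
      ∀ᵐ ω ∂P, N.nrm (f s - f t) ω ≤ |(s : ℝ) - t| * |g ω| := by
    intro s t hs ht
    filter_upwards [hlip s t hs ht, mk_ae (P := P) hζ] with ω h1 h2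
    rw [hg, h2]; exact h1
  -- Clamping to $[0,L]$ makes the lifted function globally Lipschitz on $\mathbb R$.
  let p : ℝ → ℝ≥0 := fun s => min s.toNNReal L
  have hp : ∀ s, p s ≤ L := fun s => min_le_right _ _
  have hplip : ∀ s t, |(p s : ℝ) - p t| ≤ |s - t| := by
    intro s t
    simp only [p, NNReal.coe_min, Real.coe_toNNReal']
    refine (abs_min_sub_min_le_max _ _ _ _).trans ?_
    rw [sub_self, abs_zero, max_eq_left (abs_nonneg _)]
    exact abs_max_sub_max_le_abs _ _ _
  have hFb : ∀ s, ∀ᵐ ω ∂P, N.nrm (f (p s) - f 0) ω ≤ (L : ℝ) * |g ω| := by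
    intro s
    filter_upwards [hlip' (p s) 0 (hp s) zero_le] with ω h
    refine h.trans (mul_le_mul_of_nonneg_right ?_ (abs_nonneg _))
    rw [NNReal.coe_zero, sub_zero, NNReal.abs_eq]
    exact hp s
  -- The values of $f$ need not lie in the weighted space, but its increments are dominated by
  -- $|g|$.
  let F : ℝ → N.WeightedL1 g := fun s => WeightedL1.ofLE (f (p s) - f 0) L (hFb s)
  have hFsub : ∀ s t, (F s - F t).val = f (p s) - f (p t) := fun s t => by
    rw [WeightedL1.val_sub, WeightedL1.val_ofLE, WeightedL1.val_ofLE, sub_sub_sub_cancel_right]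
  have hFlip : ∀ s t, ‖F s - F t‖ ≤ |s - t| := by
    intro s t
    refine WeightedL1.norm_le_of_nrm_le ?_ (abs_nonneg _)
    rw [hFsub]
    filter_upwards [hlip' (p s) (p t) (hp s) (hp t)] with ω h
    exact h.trans (mul_le_mul_of_nonneg_right (hplip s t) (abs_nonneg _))
  have hFc : Continuous F := by
    refine (LipschitzWith.of_dist_le_mul (K := 1) fun s t => ?_).continuous
    rw [dist_eq_norm, NNReal.coe_one, one_mul, Real.dist_eq]
    exact hFlip s t
  have hFd : ∀ x : ℝ, 0 < x → x < L → HasDerivWithinAt F 0 (Ici x) x := by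
    intro x hx0 hxL
    rw [← hasDerivWithinAt_Ioi_iff_Ici, hasDerivWithinAt_iff_tendsto_slope' self_notMem_Ioi]
    have hpx : ∀ s : ℝ, 0 < s → s < L → p s = s.toNNReal := fun s h0 hs =>
      min_eq_left (Real.toNNReal_le_iff_le_coe.2 hs.le)
    have hconv := Conv.comp (hd x.toNNReal (Real.toNNReal_pos.2 hx0)
      ((Real.toNNReal_lt_iff_lt_coe hx0.le).2 hxL)) (tendsto_toNNReal_nhdsNE hx0.le)
    -- The Lipschitz bound is decisive here: difference quotients are bounded by $|g|$, so their
    -- convergence in probability is convergence in norm.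
    refine WeightedL1.tendsto_of_conv (c := 1) zero_le_one ?_ ?_
    · filter_upwards [self_mem_nhdsWithin] with s hs
      have hs' : 0 < s - x := sub_pos.2 hs
      filter_upwards [hlip' (p s) (p x) (hp s) (hp x),
        N.nrm_constL0_smul_ae (s - x)⁻¹ (f (p s) - f (p x))] with ω h1 h2
      rw [WeightedL1.val_zero, sub_zero, slope_def_module, WeightedL1.val_smul, hFsub, h2,
        abs_of_pos (inv_pos.2 hs'), inv_mul_le_iff₀ hs', one_mul]
      refine h1.trans (mul_le_mul_of_nonneg_right ((hplip s x).trans_eq ?_) (abs_nonneg _))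
      exact abs_of_pos hs'
    · refine Conv.congr hconv ?_
      filter_upwards [self_mem_nhdsWithin, mem_nhdsWithin_of_mem_nhds (Iio_mem_nhds hxL)]
        with s hs hsL
      have hs0 : 0 < s := hx0.trans hs
      rw [slope_def_module, WeightedL1.val_smul, hFsub, hpx s hs0 hsL, hpx x hx0 hxL,
        Real.coe_toNNReal s hs0.le, Real.coe_toNNReal x hx0.le]
  have hconst : ∀ a : ℝ, 0 < a → a ≤ L → F L = F a := fun a ha haL =>
    constant_of_has_deriv_right_zero hFc.continuousOn
      (fun x hx => hFd x (ha.trans_le hx.1) hx.2) L ⟨haL, le_rfl⟩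
  -- No derivative is assumed at $0$; constancy on each $[a,L]$ with $a>0$ extends to $0$ by
  -- continuity.
  have h0 : F 0 = F L := by
    refine tendsto_nhds_unique ((hFc.tendsto 0).mono_left (nhdsWithin_le_nhds (s := Ioi 0))) ?_
    refine tendsto_const_nhds.congr' ?_
    filter_upwards [Ioc_mem_nhdsGT (NNReal.coe_pos.2 hL)] with a ha
    exact hconst a ha.1 ha.2
  have h1 := congrArg WeightedL1.val h0
  simp only [F, WeightedL1.val_ofLE, p, Real.toNNReal_zero, Real.toNNReal_coe, min_self,
    min_eq_left (zero_le : 0 ≤ L), sub_self] at h1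
  exact (sub_eq_zero.1 h1.symm)

/-- `Φ` has the derivative `-f`, is `L⁰`-Lipschitz and vanishes at infinity; so `Φ t` is the
integral of `f` over `[t, ∞)`. -/
structure IsTail (N : L0Norm P 𝕜 S) (f Φ : ℝ≥0 → S) : Prop where
  deriv : ∀ t, N.HasDeriv Φ (-f t) t
  lipschitz : ∃ ζ : Ω → ℝ, Measurable ζ ∧
    ∀ s t : ℝ≥0, ∀ᵐ ω ∂P, N.nrm (Φ s - Φ t) ω ≤ |(s : ℝ) - t| * |ζ ω|
  tendsto : N.Conv atTop Φ 0

theorem HasDeriv.sub {f h : ℝ≥0 → S} {d e : S} {t : ℝ≥0} (hf : N.HasDeriv f d t)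
    (hh : N.HasDeriv h e t) : N.HasDeriv (fun s => f s - h s) (d - e) t := by
  refine Conv.congr (Conv.sub hf hh) (Eventually.of_forall fun s => ?_)
  rw [← smul_sub, sub_sub_sub_comm]

theorem HasDeriv.map {T : S →ₗ[Ω →ₘ[P] 𝕜] S} (hT : N.ASBounded T) {f : ℝ≥0 → S} {d : S}
    {t : ℝ≥0} (hf : N.HasDeriv f d t) : N.HasDeriv (fun s => T (f s)) (T d) t := by
  refine Conv.congr (Conv.map hT hf) (Eventually.of_forall fun s => ?_)
  rw [map_smul, map_sub]

theorem HasDeriv.comp_add {f : ℝ≥0 → S} {d : S} {t h : ℝ≥0} (hf : N.HasDeriv f d (t + h)) :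
    N.HasDeriv (fun s => f (s + h)) d t := by
  have ht : Tendsto (fun s : ℝ≥0 => s + h) (𝓝[≠] t) (𝓝[≠] (t + h)) := by
    refine tendsto_nhdsWithin_iff.2 ⟨((continuous_add_const h).tendsto t).mono_left
      nhdsWithin_le_nhds, ?_⟩
    filter_upwards [self_mem_nhdsWithin] with s hs
    exact fun h' => hs (add_right_cancel h')
  refine Conv.congr (Conv.comp hf ht) (Eventually.of_forall fun s => ?_)
  rw [NNReal.coe_add, NNReal.coe_add, add_sub_add_right_eq_sub]

namespace IsTail

variable {f h Φ Ψ : ℝ≥0 → S}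

theorem sub (hΦ : N.IsTail f Φ) (hΨ : N.IsTail h Ψ) :
    N.IsTail (fun t => f t - h t) (fun t => Φ t - Ψ t) where
  deriv t := by
    have h1 := (hΦ.deriv t).sub (hΨ.deriv t)
    rwa [← neg_sub'] at h1
  lipschitz := by
    obtain ⟨ζ, hζ, h1⟩ := hΦ.lipschitz
    obtain ⟨ζ', hζ', h2⟩ := hΨ.lipschitz
    refine ⟨fun ω => |ζ ω| + |ζ' ω|, hζ.norm.add hζ'.norm, fun s t => ?_⟩
    filter_upwards [h1 s t, h2 s t, N.nrm_sub_ae (Φ s - Φ t) (Ψ s - Ψ t)] with ω h3 h4 h5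
    rw [sub_sub_sub_comm, abs_of_nonneg (by positivity : 0 ≤ |ζ ω| + |ζ' ω|)]
    linarith
  tendsto := by simpa using hΦ.tendsto.sub hΨ.tendsto

theorem map {T : S →ₗ[Ω →ₘ[P] 𝕜] S} (hT : N.ASBounded T) (hΦ : N.IsTail f Φ) :
    N.IsTail (fun t => T (f t)) (fun t => T (Φ t)) where
  deriv t := by
    rw [← map_neg]
    exact (hΦ.deriv t).map hT
  lipschitz := by
    obtain ⟨ζ, hζ, h1⟩ := hΦ.lipschitz
    obtain ⟨κ, hκ, h2⟩ := hT.exists_bound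
    refine ⟨fun ω => κ ω * ζ ω, hκ.mul hζ, fun s t => ?_⟩
    filter_upwards [h1 s t, h2 (Φ s - Φ t)] with ω h3 h4
    rw [← map_sub, abs_mul, mul_left_comm]
    exact h4.trans (mul_le_mul_of_nonneg_left h3 (abs_nonneg _))
  tendsto := by simpa using hΦ.tendsto.map hT

theorem comp_add (hΦ : N.IsTail f Φ) (h : ℝ≥0) :
    N.IsTail (fun t => f (t + h)) (fun t => Φ (t + h)) where
  deriv t := (hΦ.deriv (t + h)).comp_add
  lipschitz := by
    obtain ⟨ζ, hζ, h1⟩ := hΦ.lipschitz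
    refine ⟨ζ, hζ, fun s t => ?_⟩
    have := h1 (s + h) (t + h)
    rwa [NNReal.coe_add, NNReal.coe_add, add_sub_add_right_eq_sub] at this
  tendsto := hΦ.tendsto.comp (tendsto_atTop_mono (fun _ => le_self_add) tendsto_id)

theorem eq_zero (hΦ : N.IsTail (fun _ => 0) Φ) (t : ℝ≥0) : Φ t = 0 := by
  obtain ⟨ζ, hζ, h1⟩ := hΦ.lipschitz
  have hconst : ∀ s, Φ s = Φ 0 := fun s =>
    eq_of_hasDeriv_zero hζ (fun s t _ _ => h1 s t) fun t _ _ => by simpa using hΦ.deriv t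
  rw [hconst t]
  exact (Conv.const (Φ 0)).unique (hΦ.tendsto.congr (Eventually.of_forall hconst))

theorem unique (hΦ : N.IsTail f Φ) (hΨ : N.IsTail f Ψ) (t : ℝ≥0) : Φ t = Ψ t := by
  have h := hΦ.sub hΨ
  simp only [sub_self] at h
  exact sub_eq_zero.1 (h.eq_zero t)

end IsTail

theorem tendsto_coe_nhdsNE (t : ℝ≥0) :
    Tendsto ((↑) : ℝ≥0 → ℝ) (𝓝[≠] t) (𝓝[≠] (t : ℝ)) := by
  refine tendsto_nhdsWithin_iff.2 ⟨(NNReal.continuous_coe.tendsto t).mono_left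
    nhdsWithin_le_nhds, ?_⟩
  filter_upwards [self_mem_nhdsWithin] with s hs
  exact fun h' => hs (NNReal.coe_injective h')

/-- The bound separates into an integrable function of time and one random variable, so a single
weighted space contains all values of $f$ and the tail integral exists there. The bound with
$\arctan$ is the integral of $(1+s^2)^{-1}$ over $[t,\infty)$. -/
theorem exists_tail (hN : N.IsComplete) {f : ℝ≥0 → S} (hf : ∀ t, N.Conv (𝓝 t) f (f t))
    {ζ : Ω → ℝ} (hζ : Measurable ζ)
    (hb : ∀ s : ℝ≥0, ∀ᵐ ω ∂P, N.nrm (f s) ω ≤ (1 + (s : ℝ) ^ 2)⁻¹ * |ζ ω|) :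
    ∃ Φ : ℝ≥0 → S, N.IsTail f Φ ∧
      (∀ s t : ℝ≥0, ∀ᵐ ω ∂P, N.nrm (Φ s - Φ t) ω ≤ |(s : ℝ) - t| * |ζ ω|) ∧
      ∀ t : ℝ≥0, ∀ᵐ ω ∂P, N.nrm (Φ t) ω ≤ (Real.pi / 2 - Real.arctan t) * |ζ ω| := by
  set g : Ω →ₘ[P] ℝ := AEEqFun.mk ζ hζ.aestronglyMeasurable with hg
  have hgζ : ∀ᵐ ω ∂P, g ω = ζ ω := mk_ae hζ
  have _ : CompleteSpace (N.WeightedL1 g) := WeightedL1.completeSpace hN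
  have hb' : ∀ s : ℝ≥0, ∀ᵐ ω ∂P, N.nrm (f s) ω ≤ (1 + (s : ℝ) ^ 2)⁻¹ * |g ω| := by
    intro s
    filter_upwards [hb s, hgζ] with ω h1 h2
    rw [h2]; exact h1
  have hb1 : ∀ s : ℝ≥0, ∀ᵐ ω ∂P, N.nrm (f s) ω ≤ 1 * |g ω| := by
    intro s
    filter_upwards [hb' s] with ω h
    refine h.trans (mul_le_mul_of_nonneg_right (inv_le_one_of_one_le₀ ?_) (abs_nonneg _))
    linarith [sq_nonneg (s : ℝ)]
  let F : ℝ → N.WeightedL1 g := fun s => WeightedL1.ofLE (f s.toNNReal) 1 (hb1 _)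
  have hFc : Continuous F := by
    refine continuous_iff_continuousAt.2 fun s => ?_
    refine WeightedL1.tendsto_of_conv (c := 2) zero_le_two ?_
      ((hf s.toNNReal).comp (continuous_real_toNNReal.tendsto s))
    refine Eventually.of_forall fun r => ?_
    filter_upwards [hb1 r.toNNReal, hb1 s.toNNReal, N.nrm_sub_ae (f r.toNNReal) (f s.toNNReal)]
      with ω h1 h2 h3
    refine h3.trans ?_
    linarith
  have hφ : Integrable (fun s : ℝ => (1 + s ^ 2)⁻¹) := integrable_inv_one_add_sq
  have hFb : ∀ s : ℝ, 0 ≤ s → ∀ᵐ ω ∂P, N.nrm (F s).val ω ≤ (1 + s ^ 2)⁻¹ * |g ω| := by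
    intro s hs
    have := hb' s.toNNReal
    rwa [Real.coe_toNNReal s hs] at this
  have hFi : ∀ t : ℝ, 0 ≤ t → IntegrableOn F (Ioi t) := by
    intro t ht
    refine Integrable.mono' hφ.integrableOn hFc.aestronglyMeasurable ?_
    refine (ae_restrict_iff' measurableSet_Ioi).2 (Eventually.of_forall fun s hs => ?_)
    exact WeightedL1.norm_le_of_nrm_le (hFb s (ht.trans (le_of_lt hs))) (by positivity)
  let J : ℝ → N.WeightedL1 g := fun t => ∫ s in Ioi t, F s
  have hJ : ∀ s t : ℝ, 0 ≤ s → 0 ≤ t → J s - J t = ∫ r in s..t, F r := fun s t hs ht =>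
    intervalIntegral.integral_Ioi_sub_Ioi' (hFi s hs) (hFi t ht)
  have hlip : ∀ s t : ℝ≥0, s ≤ t →
      ∀ᵐ ω ∂P, N.nrm ((J s).val - (J t).val) ω ≤ |(s : ℝ) - t| * |g ω| := by
    intro s t hst
    have hst' : (s : ℝ) ≤ t := hst
    have h := WeightedL1.nrm_integral_le (measurableSet_Ioc (a := (s : ℝ)) (b := t))
      ((hFi s s.2).mono_set Ioc_subset_Ioi_self)
      (φ := fun _ => 1) (integrableOn_const (by simp)) (fun r hr => hb1 _)
    rw [← intervalIntegral.integral_of_le hst', ← hJ s t s.2 t.2] at h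
    rw [abs_sub_comm, abs_of_nonneg (sub_nonneg.2 hst')]
    simpa [hst'] using h
  have hlip' : ∀ s t : ℝ≥0,
      ∀ᵐ ω ∂P, N.nrm ((J s).val - (J t).val) ω ≤ |(s : ℝ) - t| * |ζ ω| := by
    intro s t
    rcases le_total s t with hst | hst
    · filter_upwards [hlip s t hst, hgζ] with ω h1 h2
      rwa [h2] at h1
    · filter_upwards [hlip t s hst, hgζ, N.nrm_sub_comm_ae (J s).val (J t).val] with ω h1 h2 h3
      rwa [h2, ← h3, abs_sub_comm] at h1
  have hbound : ∀ t : ℝ≥0, ∀ᵐ ω ∂P,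
      N.nrm (J t).val ω ≤ (Real.pi / 2 - Real.arctan t) * |ζ ω| := by
    intro t
    have h := WeightedL1.nrm_integral_le (measurableSet_Ioi (a := (t : ℝ))) (hFi t t.2)
      hφ.integrableOn fun s hs => hFb s (t.2.trans (le_of_lt hs))
    rw [integral_Ioi_inv_one_add_sq] at h
    filter_upwards [h, hgζ] with ω h1 h2
    rwa [h2] at h1
  refine ⟨fun t => (J t).val, ⟨fun t => ?_, ⟨ζ, hζ, hlip'⟩, ?_⟩, hlip', hbound⟩
  · have hd : HasDerivAt (fun s : ℝ => -∫ r in (t : ℝ)..s, F r) (-F t) t :=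
      (intervalIntegral.integral_hasDerivAt_right (hFc.intervalIntegrable _ _)
        (hFc.stronglyMeasurableAtFilter _ _) hFc.continuousAt).neg
    -- The fundamental theorem of calculus holds in norm, and norm convergence of the slopes implies
    -- convergence in probability.
    have h1 := WeightedL1.conv_of_tendsto
      ((hasDerivAt_iff_tendsto_slope.1 hd).comp (tendsto_coe_nhdsNE t))
    rw [WeightedL1.val_neg, WeightedL1.val_ofLE, Real.toNNReal_coe] at h1
    refine h1.congr (Eventually.of_forall fun s => ?_)
    rw [Function.comp_apply, slope_def_module, WeightedL1.val_smul, intervalIntegral.integral_same,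
      neg_zero, sub_zero, ← hJ t s t.2 s.2, neg_sub, WeightedL1.val_sub]
  · refine conv_zero_of_le_real hζ (r := fun t : ℝ≥0 => Real.pi / 2 - Real.arctan t) ?_
      (Eventually.of_forall fun t => ?_)
    · have h := (tendsto_nhds_of_tendsto_nhdsWithin Real.tendsto_arctan_atTop).comp
        (NNReal.tendsto_coe_atTop.2 tendsto_id)
      simpa using h.const_sub (Real.pi / 2)
    · filter_upwards [hbound t] with ω h
      rwa [mul_comm]

end L0Norm

end RandomModule

/-! ### Random exponentials: estimates, continuity and the product rule. -/

namespace RandomModule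

section ExpBounds

theorem abs_exp_sub_exp_le {a b c : ℝ} (ha : a ≤ c) (hb : b ≤ c) :
    |Real.exp a - Real.exp b| ≤ |a - b| * Real.exp c := by
  have key : ∀ a b : ℝ, a ≤ c → b ≤ a → |Real.exp a - Real.exp b| ≤ |a - b| * Real.exp c := by
    intro a b ha hab
    rw [abs_of_nonneg (sub_nonneg.2 (Real.exp_le_exp.2 hab)), abs_of_nonneg (sub_nonneg.2 hab)]
    have h1 := Real.add_one_le_exp (b - a)
    have h2 : Real.exp b = Real.exp a * Real.exp (b - a) := by
      rw [← Real.exp_add]; ring_nf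
    have h3 := Real.exp_pos a
    have h4 := Real.exp_le_exp.2 ha
    calc Real.exp a - Real.exp b ≤ (a - b) * Real.exp a := by rw [h2]; nlinarith
      _ ≤ (a - b) * Real.exp c := mul_le_mul_of_nonneg_left h4 (sub_nonneg.2 hab)
  rcases le_total b a with h | h
  · exact key a b ha h
  · rw [abs_sub_comm, abs_sub_comm a]
    exact key b a hb h

/-- Convexity gives $e^a-e^b\le(a-b)e^a$, so the Taylor remainder is at most $(a-b)(e^a-e^b)$. Its
quadratic size makes the difference quotients of $e^{\eta s}$ converge with error $|s-t|$ times a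
random variable. -/
theorem abs_exp_sub_exp_sub_le {a b c : ℝ} (ha : a ≤ c) (hb : b ≤ c) :
    |Real.exp a - Real.exp b - (a - b) * Real.exp b| ≤ (a - b) ^ 2 * Real.exp c := by
  have h1 := Real.add_one_le_exp (a - b)
  have h2 : Real.exp a = Real.exp b * Real.exp (a - b) := by
    rw [← Real.exp_add]; ring_nf
  have h3 := Real.exp_pos b
  have h5 := Real.add_one_le_exp (b - a)
  have h6 : Real.exp b = Real.exp a * Real.exp (b - a) := by
    rw [← Real.exp_add]; ring_nf
  rw [abs_of_nonneg (by rw [h2]; nlinarith)]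
  have h7 : Real.exp a - Real.exp b ≤ (a - b) * Real.exp a := by
    nlinarith [Real.exp_pos a]
  calc Real.exp a - Real.exp b - (a - b) * Real.exp b
      ≤ (a - b) * (Real.exp a - Real.exp b) := by linarith
    _ ≤ |a - b| * |Real.exp a - Real.exp b| := by rw [← abs_mul]; exact le_abs_self _
    _ ≤ |a - b| * (|a - b| * Real.exp c) :=
        mul_le_mul_of_nonneg_left (abs_exp_sub_exp_le ha hb) (abs_nonneg _)
    _ = (a - b) ^ 2 * Real.exp c := by rw [← mul_assoc, abs_mul_abs_self]; ring

theorem mul_le_abs_mul {a s L : ℝ} (h : |s| ≤ L) : a * s ≤ |a| * L :=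
  (le_abs_self _).trans (by rw [abs_mul]; exact mul_le_mul_of_nonneg_left h (abs_nonneg _))

/-- The bound by which `e^{-(η - ξ) s}` is integrable in `s`. -/
theorem exp_neg_le {d s : ℝ} (hd : 0 < d) (hs : 0 ≤ s) :
    Real.exp (-(d * s)) ≤ (1 + s ^ 2)⁻¹ * (2 * (1 + (d ^ 2)⁻¹)) := by
  -- In $1+x+x^2/2\le e^x$ with $x=ds$, the factor $2$ absorbs the $1/2$ and $d^{-2}$ turns $x^2$
  -- into $s^2$.
  have h1 := Real.quadratic_le_exp_of_nonneg (mul_nonneg hd.le hs)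
  rw [Real.exp_neg, inv_mul_eq_div, inv_le_comm₀ (Real.exp_pos _) (by positivity), inv_div]
  refine le_trans ?_ h1
  rw [div_le_iff₀ (by positivity)]
  have h2 : (d * s) ^ 2 * (d ^ 2)⁻¹ = s ^ 2 := by field_simp
  have h3 : 0 ≤ d * s := by positivity
  have h4 : 0 < (d ^ 2)⁻¹ := by positivity
  nlinarith [mul_nonneg h3 h4.le, sq_nonneg (d * s)]

end ExpBounds

namespace L0Norm

variable {Ω : Type*} [MeasurableSpace Ω] {P : Measure Ω}
  {𝕜 : Type*} [RCLike 𝕜] {S : Type*} [AddCommGroup S] [Module (Ω →ₘ[P] 𝕜) S]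
  {N : L0Norm P 𝕜 S}

theorem nrm_expK_sub_smul_ae (N : L0Norm P 𝕜 S) (η : Ω →ₘ[P] ℝ) (s t : ℝ) (x : S) :
    ∀ᵐ ω ∂P, N.nrm ((expK 𝕜 η s - expK 𝕜 η t) • x) ω =
      |Real.exp (η ω * s) - Real.exp (η ω * t)| * N.nrm x ω := by
  filter_upwards [N.nrm_smul_ae (expK 𝕜 η s - expK 𝕜 η t) x, expK_ae (𝕜 := 𝕜) η s,
    expK_ae (𝕜 := 𝕜) η t, AEEqFun.coeFn_sub (expK 𝕜 η s) (expK 𝕜 η t)] with ω h1 h2 h3 h4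
  rw [h1, h4, Pi.sub_apply, h2, h3, ← RCLike.ofReal_sub, RCLike.norm_ofReal]

theorem nrm_expK_slope_smul_ae (N : L0Norm P 𝕜 S) (η : Ω →ₘ[P] ℝ) (c s t : ℝ) (x : S) :
    ∀ᵐ ω ∂P, N.nrm ((constL0 P 𝕜 c * (expK 𝕜 η s - expK 𝕜 η t) -
      expK 𝕜 η t * ofRealL0 𝕜 η) • x) ω =
      |c * (Real.exp (η ω * s) - Real.exp (η ω * t)) - Real.exp (η ω * t) * η ω| * N.nrm x ω := by
  filter_upwards [N.nrm_smul_ae (constL0 P 𝕜 c * (expK 𝕜 η s - expK 𝕜 η t) -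
      expK 𝕜 η t * ofRealL0 𝕜 η) x, expK_ae (𝕜 := 𝕜) η s, expK_ae (𝕜 := 𝕜) η t,
    AEEqFun.coeFn_sub (expK 𝕜 η s) (expK 𝕜 η t), constL0_ae (P := P) (𝕜 := 𝕜) c,
    AEEqFun.coeFn_mul (constL0 P 𝕜 c) (expK 𝕜 η s - expK 𝕜 η t),
    AEEqFun.coeFn_mul (expK 𝕜 η t) (ofRealL0 𝕜 η), ofRealL0_ae (𝕜 := 𝕜) η,
    AEEqFun.coeFn_sub (constL0 P 𝕜 c * (expK 𝕜 η s - expK 𝕜 η t)) (expK 𝕜 η t * ofRealL0 𝕜 η)]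
    with ω h1 h2 h3 h4 h5 h6 h7 h8 h9
  rw [h1, h9, Pi.sub_apply, h6, h7, Pi.mul_apply, Pi.mul_apply, h4, h5, h8, Pi.sub_apply, h2, h3]
  rw [← RCLike.norm_ofReal (K := 𝕜)]
  push_cast
  rfl

theorem ASBounded.of_bound {T : S →ₗ[Ω →ₘ[P] 𝕜] S} {κ : Ω → ℝ} (hκ : Measurable κ)
    (h : ∀ z, ∀ᵐ ω ∂P, N.nrm (T z) ω ≤ |κ ω| * N.nrm z ω) : N.ASBounded T := by
  refine ⟨AEEqFun.mk _ hκ.norm.aestronglyMeasurable, ?_, fun z => le_mul_ae.2 ?_⟩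
  · rw [← AEEqFun.coeFn_le]
    filter_upwards [mk_ae (P := P) hκ.norm, (AEEqFun.coeFn_zero : ⇑(0 : Ω →ₘ[P] ℝ) =ᵐ[P] 0)]
      with ω h1 h2
    rw [h1, h2]
    exact norm_nonneg _
  · filter_upwards [mk_ae (P := P) hκ.norm, h z] with ω h1 h2
    rw [h1]
    exact h2

/-- Random scalars act as elements of $B(S)$, so `IsTail.map` applies to them. -/
theorem asBounded_lsmul (ζ : Ω →ₘ[P] 𝕜) : N.ASBounded (LinearMap.lsmul (Ω →ₘ[P] 𝕜) S ζ) := by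
  refine ASBounded.of_bound ζ.measurable.norm fun z => ?_
  filter_upwards [N.nrm_smul_ae ζ z] with ω h
  rw [LinearMap.lsmul_apply, h, abs_norm]

variable [IsProbabilityMeasure P] {ι : Type*} {l : Filter ι}

/-- Since $|\sigma_i|<|\tau|+1$ eventually, one random variable dominates all the exponential
factors. -/
theorem conv_expK_smul_zero (η : Ω →ₘ[P] ℝ) {σ : ι → ℝ} {τ : ℝ} (hσ : Tendsto σ l (𝓝 τ))
    {f : ι → S} (hf : N.Conv l f 0) : N.Conv l (fun i => expK 𝕜 η (σ i) • f i) 0 := by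
  have hL : ∀ᶠ i in l, |σ i| < |τ| + 1 := hσ.abs.eventually (gt_mem_nhds (lt_add_one _))
  refine conv_zero_of_le (κ := fun ω => Real.exp (|η ω| * (|τ| + 1))) ?_ hf ?_
  · exact (η.measurable.norm.mul_const _).exp
  filter_upwards [hL] with i hi
  filter_upwards [N.nrm_expK_smul_ae η (σ i) (f i), N.nonneg_ae (f i)] with ω h1 h2
  rw [h1, abs_of_pos (Real.exp_pos _)]
  exact mul_le_mul_of_nonneg_right (Real.exp_le_exp.2 (mul_le_abs_mul hi.le)) h2

theorem conv_expK_sub_smul (η : Ω →ₘ[P] ℝ) {σ : ι → ℝ} {τ : ℝ} (hσ : Tendsto σ l (𝓝 τ)) (x : S) :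
    N.Conv l (fun i => (expK 𝕜 η (σ i) - expK 𝕜 η τ) • x) 0 := by
  have hL : ∀ᶠ i in l, |σ i| < |τ| + 1 := hσ.abs.eventually (gt_mem_nhds (lt_add_one _))
  refine conv_zero_of_le_real (r := fun i => |σ i - τ|)
    (κ := fun ω => |η ω| * Real.exp (|η ω| * (|τ| + 1)) * N.nrm x ω) ?_ ?_ ?_
  · exact (η.measurable.norm.mul (η.measurable.norm.mul_const _).exp).mul (N.nrm x).measurable
  · simpa using (hσ.sub_const τ).abs
  filter_upwards [hL] with i hi
  filter_upwards [N.nrm_expK_sub_smul_ae η (σ i) τ x, N.nonneg_ae x] with ω h1 h2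
  rw [h1]
  refine le_trans ?_ (mul_le_mul_of_nonneg_right (le_abs_self _) (abs_nonneg _))
  have h3 := abs_exp_sub_exp_le (mul_le_abs_mul (a := η ω) hi.le)
    (mul_le_abs_mul (a := η ω) (lt_add_one |τ|).le)
  rw [← mul_sub, abs_mul] at h3
  calc _ ≤ |η ω| * |σ i - τ| * Real.exp (|η ω| * (|τ| + 1)) * N.nrm x ω :=
        mul_le_mul_of_nonneg_right h3 h2
    _ = _ := by ring

theorem Conv.expK_smul (η : Ω →ₘ[P] ℝ) {σ : ι → ℝ} {τ : ℝ} (hσ : Tendsto σ l (𝓝 τ))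
    {f : ι → S} {x : S} (hf : N.Conv l f x) :
    N.Conv l (fun i => expK 𝕜 η (σ i) • f i) (expK 𝕜 η τ • x) := by
  rw [← conv_sub_iff] at hf ⊢
  have h := (conv_expK_smul_zero η hσ hf).add (conv_expK_sub_smul η hσ x)
  rw [add_zero] at h
  refine h.congr (Eventually.of_forall fun i => ?_)
  module

theorem tendsto_coe_nhdsNE_nhds (t : ℝ≥0) :
    Tendsto ((↑) : ℝ≥0 → ℝ) (𝓝[≠] t) (𝓝 (t : ℝ)) :=
  (NNReal.continuous_coe.tendsto t).mono_left nhdsWithin_le_nhds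

theorem conv_expK_slope_smul (η : Ω →ₘ[P] ℝ) (t : ℝ≥0) (x : S) :
    N.Conv (𝓝[≠] t) (fun s : ℝ≥0 => (constL0 P 𝕜 ((s : ℝ) - t)⁻¹ *
      (expK 𝕜 η s - expK 𝕜 η t) - expK 𝕜 η t * ofRealL0 𝕜 η) • x) 0 := by
  have hσ := tendsto_coe_nhdsNE_nhds t
  have hL : ∀ᶠ s : ℝ≥0 in 𝓝[≠] t, |(s : ℝ)| < |(t : ℝ)| + 1 :=
    hσ.abs.eventually (gt_mem_nhds (lt_add_one _))
  refine conv_zero_of_le_real (r := fun s : ℝ≥0 => |(s : ℝ) - t|)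
    (κ := fun ω => (η ω) ^ 2 * Real.exp (|η ω| * (|(t : ℝ)| + 1)) * N.nrm x ω) ?_ ?_ ?_
  · exact ((η.measurable.pow_const 2).mul (η.measurable.norm.mul_const _).exp).mul
      (N.nrm x).measurable
  · simpa using (hσ.sub_const (t : ℝ)).abs
  filter_upwards [hL, self_mem_nhdsWithin] with s hs hne
  have hne' : (s : ℝ) - t ≠ 0 := sub_ne_zero.2 fun h => hne (NNReal.coe_injective h)
  filter_upwards [N.nrm_expK_slope_smul_ae η ((s : ℝ) - t)⁻¹ s t x, N.nonneg_ae x] with ω h1 h2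
  rw [h1]
  refine le_trans ?_ (mul_le_mul_of_nonneg_right (le_abs_self _) (abs_nonneg _))
  have h3 := abs_exp_sub_exp_sub_le (mul_le_abs_mul (a := η ω) hs.le)
    (mul_le_abs_mul (a := η ω) (lt_add_one |(t : ℝ)|).le)
  have h4 : ((s : ℝ) - t)⁻¹ * (Real.exp (η ω * s) - Real.exp (η ω * t)) -
      Real.exp (η ω * t) * η ω = ((s : ℝ) - t)⁻¹ * (Real.exp (η ω * s) - Real.exp (η ω * t) -
        (η ω * s - η ω * t) * Real.exp (η ω * t)) := by
    field_simp
  have h5 : |((s : ℝ) - t)⁻¹ * (Real.exp (η ω * s) - Real.exp (η ω * t)) -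
      Real.exp (η ω * t) * η ω| ≤ η ω ^ 2 * Real.exp (|η ω| * (|(t : ℝ)| + 1)) * |(s : ℝ) - t| := by
    rw [h4, abs_mul, abs_inv, inv_mul_le_iff₀ (abs_pos.2 hne')]
    refine h3.trans_eq ?_
    rw [← mul_sub, mul_pow, ← sq_abs ((s : ℝ) - t)]
    ring
  calc _ ≤ η ω ^ 2 * Real.exp (|η ω| * (|(t : ℝ)| + 1)) * |(s : ℝ) - t| * N.nrm x ω :=
        mul_le_mul_of_nonneg_right h5 h2
    _ = _ := by ring

theorem HasDeriv.expK_smul (η : Ω →ₘ[P] ℝ) {f : ℝ≥0 → S} {d : S} {t : ℝ≥0}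
    (hf : N.HasDeriv f d t) :
    N.HasDeriv (fun s => expK 𝕜 η s • f s) (expK 𝕜 η t • (d + ofRealL0 𝕜 η • f t)) t := by
  have hσ := tendsto_coe_nhdsNE_nhds t
  have h1 := conv_expK_smul_zero η hσ (conv_sub_iff.2 hf)
  -- The error in the product rule is a sum of three null terms: the error in the slope of $f$, the
  -- increment of the exponential applied to $d$, and the error in the slope of the exponential
  -- applied to $f(t)$.
  have h := (h1.add (conv_expK_sub_smul η hσ d)).add (conv_expK_slope_smul η t (f t))
  rw [add_zero, add_zero] at h
  refine conv_sub_iff.1 (h.congr (Eventually.of_forall fun i => ?_))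
  module

end L0Norm

end RandomModule

/-! ### Construction of the maps $E(t)$ from tail integrals. -/

namespace RandomModule

namespace L0Norm

variable {Ω : Type*} [MeasurableSpace Ω] {P : Measure Ω} [IsProbabilityMeasure P]
  {𝕜 : Type*} [RCLike 𝕜] {S : Type*} [AddCommGroup S] [Module (Ω →ₘ[P] 𝕜) S]
  {N : L0Norm P 𝕜 S}

/-- The maps `E t = C⁻¹ W(t) R`, where `R = R_C(η, A)` is the `C`-resolvent of the generator. -/
structure IsResolventFamily (N : L0Norm P 𝕜 S) (C : S →ₗ[Ω →ₘ[P] 𝕜] S)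
    (W : ℝ≥0 → S →ₗ[Ω →ₘ[P] 𝕜] S) (η : Ω →ₘ[P] ℝ) (E : ℝ≥0 → S →ₗ[Ω →ₘ[P] 𝕜] S) : Prop where
  bound : ∀ L : ℝ≥0, ∃ κ : Ω → ℝ, Measurable κ ∧ ∀ t ≤ L, ∀ z,
    ∀ᵐ ω ∂P, N.nrm (E t z) ω ≤ |κ ω| * N.nrm z ω
  lipschitz : ∀ L : ℝ≥0, ∃ κ : Ω → ℝ, Measurable κ ∧ ∀ s ≤ L, ∀ t ≤ L, ∀ z,
    ∀ᵐ ω ∂P, N.nrm (E s z - E t z) ω ≤ |(s : ℝ) - t| * (|κ ω| * N.nrm z ω)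
  deriv : ∀ z t, N.HasDeriv (fun s => E s z) (ofRealL0 𝕜 η • E t z - W t z) t
  apply_eq : ∀ t z, C (E t z) = W t (E 0 z)
  comm : ∀ t z, W t (E 0 z) = E 0 (W t z)

variable {C : S →ₗ[Ω →ₘ[P] 𝕜] S} {W : ℝ≥0 → S →ₗ[Ω →ₘ[P] 𝕜] S} {M ξ η : Ω →ₘ[P] ℝ}

theorem IsCSemigroup.comm (hW : N.IsCSemigroup C W) (s t : ℝ≥0) (x : S) :
    W s (W t x) = W t (W s x) := by
  rw [← hW.comp, ← hW.comp, add_comm]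

theorem IsCSemigroup.comm_C (hW : N.IsCSemigroup C W) (t : ℝ≥0) (x : S) :
    W t (C x) = C (W t x) := by
  rw [← hW.zero, hW.comm]

theorem IsCSemigroup.conv_apply (hW : N.IsCSemigroup C W) (x : S) (t : ℝ≥0) :
    N.Conv (𝓝 t) (fun s => W s x) (W t x) :=
  continuous_iff.1 (hW.continuous x) t

/-- `e^{-η s} W(s) z`. -/
noncomputable def scaled (W : ℝ≥0 → S →ₗ[Ω →ₘ[P] 𝕜] S) (η : Ω →ₘ[P] ℝ) (z : S) (s : ℝ≥0) : S :=
  expK 𝕜 η (-(s : ℝ)) • W s z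

theorem conv_scaled (hW : N.IsCSemigroup C W) (z : S) (t : ℝ≥0) :
    N.Conv (𝓝 t) (scaled W η z) (scaled W η z t) :=
  (hW.conv_apply z t).expK_smul η (NNReal.continuous_coe.tendsto t).neg

theorem exists_scaled_bound (hW : W ∈ N.H C M ξ) (hη : η ∈ G ξ) :
    ∃ κ : Ω → ℝ, Measurable κ ∧ ∀ z, ∀ s : ℝ≥0, ∀ᵐ ω ∂P,
      N.nrm (scaled W η z s) ω ≤ (1 + (s : ℝ) ^ 2)⁻¹ * (|κ ω| * N.nrm z ω) := by
  refine ⟨fun ω => |M ω| * (2 * (1 + ((η ω - ξ ω) ^ 2)⁻¹)), ?_, fun z s => ?_⟩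
  · exact M.measurable.norm.mul ((((η.measurable.sub ξ.measurable).pow_const 2).inv.const_add
      1).const_mul 2)
  filter_upwards [N.nrm_expK_smul_ae η (-(s : ℝ)) (W s z), le_mul_ae.1 (hW.2 s z),
    AEEqFun.coeFn_mul M (expL0 ξ s), expL0_ae ξ s, N.nonneg_ae z, hη] with ω h1 h2 h3 h4 h5 h6
  have h7 := exp_neg_le (sub_pos.2 h6) s.2
  have h8 : 0 ≤ |M ω| * (2 * (1 + ((η ω - ξ ω) ^ 2)⁻¹)) := by positivity
  rw [scaled, h1, abs_of_nonneg h8]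
  rw [h3, Pi.mul_apply, h4] at h2
  calc Real.exp (η ω * -(s : ℝ)) * N.nrm (W s z) ω
      ≤ Real.exp (η ω * -(s : ℝ)) * (|M ω| * Real.exp (ξ ω * s) * N.nrm z ω) := by
        refine mul_le_mul_of_nonneg_left (h2.trans ?_) (Real.exp_pos _).le
        refine mul_le_mul_of_nonneg_right ?_ h5
        exact mul_le_mul_of_nonneg_right (le_abs_self _) (Real.exp_pos _).le
    _ = Real.exp (-((η ω - ξ ω) * s)) * (|M ω| * N.nrm z ω) := by
        rw [show -((η ω - ξ ω) * (s : ℝ)) = η ω * -(s : ℝ) + ξ ω * s by ring, Real.exp_add]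
        ring
    _ ≤ ((1 + (s : ℝ) ^ 2)⁻¹ * (2 * (1 + ((η ω - ξ ω) ^ 2)⁻¹))) * (|M ω| * N.nrm z ω) :=
        mul_le_mul_of_nonneg_right h7 (by positivity)
    _ = _ := by ring

/-- With $\Phi_z(t)=\int_t^\infty e^{-\eta s}W(s)z\,ds$, the choice is $E(t)z=e^{\eta t}\Phi_z(t)$.
Linearity in $z$, commutation with $W$ and the shift identity all follow from `IsTail.unique`. -/
theorem exists_isResolventFamily (hN : N.IsComplete) (hW : W ∈ N.H C M ξ) (hη : η ∈ G ξ) :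
    ∃ E : ℝ≥0 → S →ₗ[Ω →ₘ[P] 𝕜] S, N.IsResolventFamily C W η E := by
  obtain ⟨κ, hκ, hb⟩ := exists_scaled_bound hW hη
  have hW1 := hW.1
  have hex : ∀ z, ∃ Φ : ℝ≥0 → S, N.IsTail (scaled W η z) Φ ∧
      (∀ s t : ℝ≥0, ∀ᵐ ω ∂P, N.nrm (Φ s - Φ t) ω ≤ |(s : ℝ) - t| * (|κ ω| * N.nrm z ω)) ∧
      ∀ t : ℝ≥0, ∀ᵐ ω ∂P, N.nrm (Φ t) ω ≤ 2 * (|κ ω| * N.nrm z ω) := by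
    intro z
    have habs : ∀ᵐ ω ∂P, |(|κ ω| * N.nrm z ω)| = |κ ω| * N.nrm z ω := by
      filter_upwards [N.nonneg_ae z] with ω h
      exact abs_of_nonneg (mul_nonneg (abs_nonneg _) h)
    obtain ⟨Φ, h1, h2, h3⟩ := exists_tail hN (conv_scaled (η := η) hW1 z)
      (ζ := fun ω => |κ ω| * N.nrm z ω) (hκ.norm.mul (N.nrm z).measurable) fun s => by
        filter_upwards [hb z s, habs] with ω h4 h5
        rw [h5]; exact h4
    refine ⟨Φ, h1, fun s t => ?_, fun t => ?_⟩
    · filter_upwards [h2 s t, habs] with ω h4 h5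
      rwa [h5] at h4
    · filter_upwards [h3 t, habs] with ω h4 h5
      rw [← h5]
      refine h4.trans (mul_le_mul_of_nonneg_right ?_ (abs_nonneg _))
      have h6 : 0 ≤ Real.arctan t := Real.arctan_nonneg.2 t.2
      linarith [Real.pi_le_four]
  choose Φ hΦ hlip hbd using hex
  have hsmul : ∀ (ζ : Ω →ₘ[P] 𝕜) z t, Φ (ζ • z) t = ζ • Φ z t := by
    intro ζ z t
    have h := (hΦ z).map (asBounded_lsmul ζ)
    have h' : (fun s => LinearMap.lsmul (Ω →ₘ[P] 𝕜) S ζ (scaled W η z s)) =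
        scaled W η (ζ • z) := by
      funext s
      rw [LinearMap.lsmul_apply, scaled, scaled, map_smul, smul_comm]
    rw [h'] at h
    exact (hΦ (ζ • z)).unique h t
  have hadd : ∀ x y t, Φ (x + y) t = Φ x t + Φ y t := by
    intro x y t
    have h := (hΦ (x + y)).sub (hΦ y)
    have h' : (fun s => scaled W η (x + y) s - scaled W η y s) = scaled W η x := by
      funext s
      rw [scaled, scaled, scaled, map_add, smul_add, add_sub_cancel_right]
    rw [h'] at h
    exact (sub_eq_iff_eq_add.1 (h.unique (hΦ x) t))
  have hcomm : ∀ h z t, W h (Φ z t) = Φ (W h z) t := by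
    intro h z t
    have h1 := (hΦ z).map (hW1.asBounded h)
    have h' : (fun s => W h (scaled W η z s)) = scaled W η (W h z) := by
      funext s
      rw [scaled, scaled, map_smul, hW1.comm]
    rw [h'] at h1
    exact h1.unique (hΦ (W h z)) t
  have hshift : ∀ h z t, W h (Φ z t) = C (expK 𝕜 η (h : ℝ) • Φ z (t + h)) := by
    intro h z t
    have h1 := (hΦ z).map (hW1.asBounded h)
    -- Both sides are tails of $s\mapsto W(h)e^{-\eta s}W(s)z$, because $CW(s+h)=W(h)W(s)$ and
    -- $e^{\eta h}e^{-\eta(s+h)}=e^{-\eta s}$.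
    have h2 := (((hΦ z).comp_add h).map (asBounded_lsmul (expK 𝕜 η (h : ℝ)))).map hW1.asBounded_C
    have h' : (fun s => C (LinearMap.lsmul (Ω →ₘ[P] 𝕜) S (expK 𝕜 η (h : ℝ))
        (scaled W η z (s + h)))) = fun s => W h (scaled W η z s) := by
      funext s
      rw [LinearMap.lsmul_apply, scaled, scaled, smul_smul, ← expK_add, map_smul, hW1.comp,
        map_smul, NNReal.coe_add]
      congr 2
      ring
    rw [h'] at h2
    exact h1.unique h2 t
  let E : ℝ≥0 → S →ₗ[Ω →ₘ[P] 𝕜] S := fun t =>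
    { toFun := fun z => expK 𝕜 η (t : ℝ) • Φ z t
      map_add' := fun x y => by rw [hadd, smul_add]
      map_smul' := fun ζ x => by rw [hsmul, smul_comm, RingHom.id_apply] }
  have hE : ∀ t z, E t z = expK 𝕜 η (t : ℝ) • Φ z t := fun t z => rfl
  have hE0 : ∀ z, E 0 z = Φ z 0 := fun z => by
    rw [hE, NNReal.coe_zero, expK_zero, one_smul]
  refine ⟨E, ⟨fun L => ?_, fun L => ?_, fun z t => ?_, fun t z => ?_, fun t z => ?_⟩⟩
  · refine ⟨fun ω => Real.exp (|η ω| * L) * (2 * |κ ω|),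
      (η.measurable.norm.mul_const _).exp.mul (hκ.norm.const_mul 2), fun t ht z => ?_⟩
    filter_upwards [N.nrm_expK_smul_ae η t (Φ z t), hbd z t, N.nonneg_ae (Φ z t)] with ω h1 h2 h3
    have h4 : Real.exp (η ω * t) ≤ Real.exp (|η ω| * L) :=
      Real.exp_le_exp.2 (mul_le_abs_mul (by rw [NNReal.abs_eq]; exact ht))
    have h5 : 0 ≤ Real.exp (|η ω| * L) * (2 * |κ ω|) := by positivity
    rw [hE, h1, abs_of_nonneg h5]
    calc _ ≤ Real.exp (|η ω| * L) * (2 * (|κ ω| * N.nrm z ω)) :=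
          mul_le_mul h4 h2 h3 (Real.exp_pos _).le
      _ = _ := by ring
  · refine ⟨fun ω => Real.exp (|η ω| * L) * |κ ω| * (1 + 2 * |η ω|),
      ((η.measurable.norm.mul_const _).exp.mul hκ.norm).mul
        ((η.measurable.norm.const_mul 2).const_add 1), fun s hs t ht z => ?_⟩
    have hsplit : E s z - E t z = expK 𝕜 η (s : ℝ) • (Φ z s - Φ z t) +
        (expK 𝕜 η (s : ℝ) - expK 𝕜 η (t : ℝ)) • Φ z t := by
      rw [hE, hE]; module
    filter_upwards [N.nrm_expK_smul_ae η s (Φ z s - Φ z t),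
      N.nrm_expK_sub_smul_ae η s t (Φ z t), hbd z t, hlip z s t, N.nonneg_ae (Φ z t),
      N.nonneg_ae (Φ z s - Φ z t), N.nonneg_ae z,
      N.nrm_add_ae (expK 𝕜 η (s : ℝ) • (Φ z s - Φ z t))
        ((expK 𝕜 η (s : ℝ) - expK 𝕜 η (t : ℝ)) • Φ z t)] with ω h1 h2 h3 h4 h5 h6 h7 h8
    have hs' : η ω * s ≤ |η ω| * L := mul_le_abs_mul (by rw [NNReal.abs_eq]; exact hs)
    have ht' : η ω * t ≤ |η ω| * L := mul_le_abs_mul (by rw [NNReal.abs_eq]; exact ht)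
    have h9 := abs_exp_sub_exp_le hs' ht'
    rw [← mul_sub, abs_mul] at h9
    have h10 : 0 ≤ Real.exp (|η ω| * L) * |κ ω| * (1 + 2 * |η ω|) := by positivity
    rw [hsplit, abs_of_nonneg h10]
    rw [h1, h2] at h8
    refine h8.trans ?_
    calc _ ≤ Real.exp (|η ω| * L) * (|(s : ℝ) - t| * (|κ ω| * N.nrm z ω)) +
          |η ω| * |(s : ℝ) - t| * Real.exp (|η ω| * L) * (2 * (|κ ω| * N.nrm z ω)) :=
          add_le_add (mul_le_mul (Real.exp_le_exp.2 hs') h4 h6 (Real.exp_pos _).le)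
            (mul_le_mul h9 h3 h5 (by positivity))
      _ = _ := by ring
  · have h := ((hΦ z).deriv t).expK_smul η
    have h' : expK 𝕜 η (t : ℝ) • (-scaled W η z t + ofRealL0 𝕜 η • Φ z t) =
        ofRealL0 𝕜 η • E t z - W t z := by
      rw [hE, scaled, smul_add, smul_neg, smul_smul, ← expK_add, add_neg_cancel, expK_zero,
        one_smul, smul_comm, neg_add_eq_sub]
    rw [h'] at h
    exact h
  · rw [hE0, hshift, zero_add, hE]
  · rw [hE0, hE0, hcomm]

end L0Norm

end RandomModule

/-! ### The generator, its $C$-resolvent, and the Cauchy problem. -/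

namespace RandomModule

namespace L0Norm

variable {Ω : Type*} [MeasurableSpace Ω] {P : Measure Ω} [IsProbabilityMeasure P]
  {𝕜 : Type*} [RCLike 𝕜] {S : Type*} [AddCommGroup S] [Module (Ω →ₘ[P] 𝕜) S]
  {N : L0Norm P 𝕜 S}
  {C : S →ₗ[Ω →ₘ[P] 𝕜] S} {W : ℝ≥0 → S →ₗ[Ω →ₘ[P] 𝕜] S} {M ξ η : Ω →ₘ[P] ℝ}

theorem tendsto_const_add_nhdsGT (t : ℝ≥0) :
    Tendsto (fun s : ℝ≥0 => t + s) (𝓝[>] 0) (𝓝[≠] t) := by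
  refine tendsto_nhdsWithin_iff.2 ⟨?_, ?_⟩
  · have h := (continuous_const_add t).tendsto (0 : ℝ≥0)
    rw [add_zero] at h
    exact h.mono_left nhdsWithin_le_nhds
  · filter_upwards [self_mem_nhdsWithin] with s hs
    exact (lt_add_of_pos_right t hs).ne'

theorem tendsto_const_sub_nhdsNE {s t : ℝ≥0} (hst : s < t) :
    Tendsto (fun r : ℝ≥0 => t - r) (𝓝[≠] s) (𝓝[≠] (t - s)) := by
  refine tendsto_nhdsWithin_iff.2 ⟨?_, ?_⟩
  · exact ((continuous_const.sub continuous_id).tendsto s).mono_left nhdsWithin_le_nhds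
  · filter_upwards [self_mem_nhdsWithin, mem_nhdsWithin_of_mem_nhds (Iio_mem_nhds hst)] with r hr hrt
    intro h
    refine hr ?_
    have h1 : t - r = t - s := h
    exact (tsub_right_inj (le_of_lt hrt) hst.le).1 h1

/-- If `C u(t) = W(t) u₀` and `u` is differentiable at `t`, then `A u(t) = u'(t)`. -/
theorem mem_generator_of_hasDeriv (hW : N.IsCSemigroup C W) {u : ℝ≥0 → S} {u₀ d : S} {t : ℝ≥0}
    (hu : ∀ t, C (u t) = W t u₀) (hd : N.HasDeriv u d t) :
    ∃ hx : u t ∈ (N.generator C W).domain, N.generator C W ⟨u t, hx⟩ = d := by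
  rw [N.mem_generator_iff hW.injective_C]
  have h := Conv.map hW.asBounded_C (Conv.comp hd (tendsto_const_add_nhdsGT t))
  refine h.congr (Eventually.of_forall fun s => ?_)
  -- After one more application of $C$, both sides equal $CW(t+s)u_0$. The quotient defining $Au(t)$
  -- is therefore $C$ applied to a difference quotient of $u$.
  have h1 : W s (u t) = C (u (t + s)) := by
    refine hW.injective_C ?_
    rw [← hW.comm_C, hu, ← hW.comp, hu]
  rw [h1, map_smul, map_sub, NNReal.coe_add, add_sub_cancel_left]

theorem generator_conv (hW : N.IsCSemigroup C W) (x : (N.generator C W).domain) :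
    N.Conv (𝓝[>] 0) (fun s : ℝ≥0 => constL0 P 𝕜 ((s : ℝ)⁻¹) • (W s (x : S) - C (x : S)))
      (C (N.generator C W x)) :=
  (N.mem_generator_iff hW.injective_C W x _).1 ⟨x.2, rfl⟩

namespace IsResolventFamily

variable {E : ℝ≥0 → S →ₗ[Ω →ₘ[P] 𝕜] S}

theorem asBounded (hE : N.IsResolventFamily C W η E) (t : ℝ≥0) : N.ASBounded (E t) := by
  obtain ⟨κ, hκ, h⟩ := hE.bound t
  exact ASBounded.of_bound hκ (h t le_rfl)

theorem mem_generator (hE : N.IsResolventFamily C W η E) (hW : N.IsCSemigroup C W) (z : S)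
    (t : ℝ≥0) : ∃ hx : E t z ∈ (N.generator C W).domain,
      N.generator C W ⟨E t z, hx⟩ = ofRealL0 𝕜 η • E t z - W t z :=
  mem_generator_of_hasDeriv hW (u := fun t => E t z) (fun t => hE.apply_eq t z) (hE.deriv z t)

theorem exists_sub_generator_eq (hE : N.IsResolventFamily C W η E) (hW : N.IsCSemigroup C W)
    (z : S) : ∃ hx : E 0 z ∈ (N.generator C W).domain,
      ofRealL0 𝕜 η • E 0 z - N.generator C W ⟨E 0 z, hx⟩ = C z := by
  obtain ⟨hx, h⟩ := hE.mem_generator hW z 0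
  exact ⟨hx, by rw [h, sub_sub_cancel, hW.zero]⟩

theorem comm_C (hE : N.IsResolventFamily C W η E) (hW : N.IsCSemigroup C W) (z : S) :
    C (E 0 z) = E 0 (C z) := by
  rw [← hW.zero, hE.comm]

theorem injective_zero (hE : N.IsResolventFamily C W η E) (hW : N.IsCSemigroup C W) :
    Function.Injective (E 0) := by
  refine (injective_iff_map_eq_zero _).2 fun z hz => ?_
  obtain ⟨hx, h⟩ := hE.exists_sub_generator_eq hW z
  have h0 : (⟨E 0 z, hx⟩ : (N.generator C W).domain) = 0 := Subtype.ext hz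
  rw [h0, LinearPMap.map_zero, hz, smul_zero, sub_zero] at h
  exact hW.injective_C (by rw [← h, map_zero])

/-- Applying $E(0)$ to the quotients $(W(s)x-Cx)/s$ gives $C(E(s)x-E(0)x)/s$. Comparing limits and
cancelling $C$ yields $E(0)Ax=\eta E(0)x-Cx$. -/
theorem zero_sub_generator (hE : N.IsResolventFamily C W η E) (hW : N.IsCSemigroup C W)
    (x : (N.generator C W).domain) :
    E 0 (ofRealL0 𝕜 η • (x : S) - N.generator C W x) = C (x : S) := by
  have h1 := (generator_conv hW x).map (hE.asBounded 0)
  have h2 := (Conv.comp (hE.deriv x 0) (tendsto_const_add_nhdsGT 0)).map hW.asBounded_C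
  have h3 : E 0 (C (N.generator C W x)) = C (ofRealL0 𝕜 η • E 0 (x : S) - W 0 (x : S)) := by
    refine h1.unique (h2.congr (Eventually.of_forall fun s => ?_))
    rw [zero_add, NNReal.coe_zero, sub_zero, map_smul, map_smul, map_sub, map_sub, hE.apply_eq,
      hE.apply_eq, hE.comm, hE.comm, hW.zero]
  rw [← hE.comm_C hW] at h3
  have h4 := hW.injective_C h3
  rw [map_sub, map_smul, h4, sub_sub_cancel]
  exact LinearMap.congr_fun hW.zero _

theorem sub_generator (hE : N.IsResolventFamily C W η E) (hW : N.IsCSemigroup C W)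
    (x : (N.generator C W).domain) (t : ℝ≥0) :
    E t (ofRealL0 𝕜 η • (x : S) - N.generator C W x) = W t (x : S) := by
  refine hW.injective_C ?_
  rw [hE.apply_eq, hE.zero_sub_generator hW, hW.comm_C]

theorem mem_cResolventSet (hE : N.IsResolventFamily C W η E) (hW : N.IsCSemigroup C W) :
    ofRealL0 𝕜 η ∈ cResolventSet C (N.generator C W) := by
  constructor
  · intro x y hxy
    have h := congrArg (E 0) hxy
    simp only at h
    rw [hE.zero_sub_generator hW, hE.zero_sub_generator hW] at h
    exact Subtype.ext (hW.injective_C h)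
  · rintro _ ⟨z, rfl⟩
    obtain ⟨hx, h⟩ := hE.exists_sub_generator_eq hW z
    exact ⟨⟨E 0 z, hx⟩, h⟩

theorem cResolvent_eq (hE : N.IsResolventFamily C W η E) (hW : N.IsCSemigroup C W)
    (hρ : ofRealL0 𝕜 η ∈ cResolventSet C (N.generator C W)) (z : S) :
    cResolvent hρ z = E 0 z :=
  (cResolvent_eq_iff hρ _ _).2 (hE.exists_sub_generator_eq hW z)

theorem conv_apply (hE : N.IsResolventFamily C W η E) (z : S) (t : ℝ≥0) :
    N.Conv (𝓝 t) (fun s => E s z) (E t z) := by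
  obtain ⟨κ, hκ, h⟩ := hE.lipschitz (t + 1)
  refine conv_sub_iff.1 (conv_zero_of_le_real (κ := fun ω => |κ ω| * N.nrm z ω)
    (r := fun s : ℝ≥0 => |(s : ℝ) - t|) (hκ.norm.mul (N.nrm z).measurable) ?_ ?_)
  · simpa using ((NNReal.continuous_coe.tendsto t).sub_const (t : ℝ)).abs
  · filter_upwards [Iio_mem_nhds (lt_add_one t)] with s hs
    filter_upwards [h s (le_of_lt hs) t le_self_add z] with ω h1
    rw [mul_comm]
    exact h1.trans (mul_le_mul_of_nonneg_left (le_abs_self _) (abs_nonneg _))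

theorem locallyL0Lipschitz (hE : N.IsResolventFamily C W η E) (z : S) :
    N.LocallyL0Lipschitz fun t => E t z := by
  intro L _
  obtain ⟨κ, hκ, h⟩ := hE.lipschitz L
  have hm : Measurable fun ω => |κ ω| * N.nrm z ω := hκ.norm.mul (N.nrm z).measurable
  refine ⟨AEEqFun.mk _ hm.aestronglyMeasurable, ?_, fun s t hs ht => ?_⟩
  · rw [← AEEqFun.coeFn_le]
    filter_upwards [mk_ae (P := P) hm, N.nonneg_ae z,
      (AEEqFun.coeFn_zero : ⇑(0 : Ω →ₘ[P] ℝ) =ᵐ[P] 0)] with ω h1 h2 h3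
    rw [h1, h3]
    exact mul_nonneg (abs_nonneg _) h2
  · rw [← AEEqFun.coeFn_le]
    filter_upwards [mk_ae (P := P) hm, h s hs t ht z,
      AEEqFun.coeFn_smul |(s : ℝ) - t| (AEEqFun.mk _ hm.aestronglyMeasurable : Ω →ₘ[P] ℝ)]
      with ω h1 h2 h3
    rw [h3, Pi.smul_apply, h1, smul_eq_mul]
    exact h2

theorem isSolution (hE : N.IsResolventFamily C W η E) (hW : N.IsCSemigroup C W) (z : S) :
    N.IsSolution (N.generator C W) (E 0 z) fun t => E t z := by
  have hcont : ∀ t, N.Conv (𝓝 t) (fun s => ofRealL0 𝕜 η • E s z - W s z)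
      (ofRealL0 𝕜 η • E t z - W t z) := fun t =>
    ((hE.conv_apply z t).smul _).sub (hW.conv_apply z t)
  refine ⟨fun t => (hE.mem_generator hW z t).1, continuous_iff.2 fun t => ?_,
    ⟨_, continuous_iff.2 hcont, hE.deriv z⟩, fun t _ => ?_, rfl⟩
  -- Graph-norm continuity reduces to continuity of $E(s)z$ and of $AE(s)z=\eta E(s)z-W(s)z$.
  · refine conv_iff.2 (NullInProb.mono
      ((conv_iff.1 (hE.conv_apply z t)).add (conv_iff.1 (hcont t))) ?_)
    refine Eventually.of_forall fun s => ?_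
    have h1 := (hE.mem_generator hW z s).2
    have h2 := (hE.mem_generator hW z t).2
    change ∀ᵐ ω ∂P, (N.nrm (E s z - E t z) + N.nrm (N.generator C W
      (⟨E s z, _⟩ - ⟨E t z, _⟩))) ω ≤ _
    rw [LinearPMap.map_sub, h1, h2]
    filter_upwards [AEEqFun.coeFn_add (N.nrm (E s z - E t z)) (N.nrm
      (ofRealL0 𝕜 η • E s z - W s z - (ofRealL0 𝕜 η • E t z - W t z)))] with ω h3
    exact h3.le
  · rw [(hE.mem_generator hW z t).2]
    exact hE.deriv z t

/-- The function `s ↦ E(t - s) v(s)` has the derivative zero, for every solution `v`. -/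
theorem hasDeriv_apply_solution (hE : N.IsResolventFamily C W η E) (hW : N.IsCSemigroup C W)
    {v : ℝ≥0 → S} {s t : ℝ≥0} (hst : s < t) (x : (N.generator C W).domain) (hx : v s = x)
    (hv : N.HasDeriv v (N.generator C W x) s) : N.HasDeriv (fun r => E (t - r) (v r)) 0 s := by
  have hsub := tendsto_const_sub_nhdsNE hst
  obtain ⟨κ, hκ, hb⟩ := hE.bound t
  -- The quotient splits into $E(t-r)$ applied to the error in the slope of $v$, the term
  -- $E(t-r)Ax$, and the slope of $r\mapsto E(t-r)x$. One random variable bounds all $E(t-r)$, since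
  -- truncated subtraction keeps $t-r\le t$.
  have h1 : N.Conv (𝓝[≠] s) (fun r : ℝ≥0 => E (t - r)
      (constL0 P 𝕜 (((r : ℝ) - s)⁻¹) • (v r - v s) - N.generator C W x)) 0 :=
    conv_zero_of_le hκ (conv_sub_iff.2 hv)
      (Eventually.of_forall fun r => hb (t - r) tsub_le_self _)
  have h2 := Conv.comp (hE.conv_apply (N.generator C W x) (t - s))
    (hsub.mono_right nhdsWithin_le_nhds)
  have h3 := (Conv.comp (hE.deriv (x : S) (t - s)) hsub).neg
  have h := (h1.add h2).add h3
  -- The limits cancel by $E(t-s)(\eta-A)x=W(t-s)x$.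
  have h0 : 0 + E (t - s) (N.generator C W x) +
      -(ofRealL0 𝕜 η • E (t - s) (x : S) - W (t - s) (x : S)) = 0 := by
    rw [← hE.sub_generator hW x (t - s), map_sub, map_smul]
    abel
  rw [h0] at h
  refine Conv.congr h ?_
  filter_upwards [mem_nhdsWithin_of_mem_nhds (Iio_mem_nhds hst)] with r hr
  have hc : (((t - r : ℝ≥0) : ℝ) - ((t - s : ℝ≥0) : ℝ))⁻¹ = -((r : ℝ) - s)⁻¹ := by
    rw [NNReal.coe_sub (le_of_lt hr), NNReal.coe_sub hst.le, ← inv_neg]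
    congr 1
    ring
  rw [hc, constL0_neg, hx, map_sub, map_smul, map_sub]
  module

theorem lipschitz_apply (hE : N.IsResolventFamily C W η E) {v : ℝ≥0 → S}
    (hv : N.LocallyL0Lipschitz v) (t : ℝ≥0) :
    ∃ ζ : Ω → ℝ, Measurable ζ ∧ ∀ s r : ℝ≥0, s ≤ t → r ≤ t →
      ∀ᵐ ω ∂P, N.nrm (E (t - s) (v s) - E (t - r) (v r)) ω ≤ |(s : ℝ) - r| * |ζ ω| := by
  obtain ⟨ζ, hζ, h1⟩ := hv.exists_bound t
  obtain ⟨κ, hκ, h2⟩ := hE.bound t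
  obtain ⟨κ', hκ', h3⟩ := hE.lipschitz t
  -- The first summand handles the increment of $v$, the second that of $E$ at $v(r)$, where
  -- $\|v(r)\|\le t|\zeta|+\|v(0)\|$.
  refine ⟨fun ω => |κ ω| * |ζ ω| + |κ' ω| * (t * |ζ ω| + N.nrm (v 0) ω), ?_,
    fun s r hs hr => ?_⟩
  · exact (hκ.norm.mul hζ.norm).add
      (hκ'.norm.mul ((hζ.norm.const_mul _).add (N.nrm (v 0)).measurable))
  have hsplit : E (t - s) (v s) - E (t - r) (v r) =
      E (t - s) (v s - v r) + (E (t - s) (v r) - E (t - r) (v r)) := by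
    rw [map_sub]; abel
  have hvr := N.nrm_add_ae (v r - v 0) (v 0)
  rw [sub_add_cancel] at hvr
  filter_upwards [h1 s hs r hr, h2 (t - s) tsub_le_self (v s - v r),
    h3 (t - s) tsub_le_self (t - r) tsub_le_self (v r), h1 r hr 0 zero_le, N.nonneg_ae (v 0),
    N.nrm_add_ae (E (t - s) (v s - v r)) (E (t - s) (v r) - E (t - r) (v r)), hvr]
    with ω g1 g2 g3 g4 g5 g6 g7
  have hc : |((t - s : ℝ≥0) : ℝ) - ((t - r : ℝ≥0) : ℝ)| = |(s : ℝ) - r| := by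
    rw [NNReal.coe_sub hs, NNReal.coe_sub hr, abs_sub_comm]
    congr 1
    ring
  rw [hc] at g3
  have g8 : N.nrm (v r) ω ≤ t * |ζ ω| + N.nrm (v 0) ω := by
    refine g7.trans (add_le_add_left (g4.trans (mul_le_mul_of_nonneg_right ?_ (abs_nonneg _))) _)
    rw [NNReal.coe_zero, sub_zero, NNReal.abs_eq]
    exact hr
  have g9 : 0 ≤ |κ ω| * |ζ ω| + |κ' ω| * (t * |ζ ω| + N.nrm (v 0) ω) := by positivity
  rw [hsplit, abs_of_nonneg g9]
  calc _ ≤ |κ ω| * (|(s : ℝ) - r| * |ζ ω|) +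
        |(s : ℝ) - r| * (|κ' ω| * (t * |ζ ω| + N.nrm (v 0) ω)) := by
        refine g6.trans (add_le_add (g2.trans ?_) (g3.trans ?_))
        · exact mul_le_mul_of_nonneg_left g1 (abs_nonneg _)
        · exact mul_le_mul_of_nonneg_left
            (mul_le_mul_of_nonneg_left g8 (abs_nonneg _)) (abs_nonneg _)
    _ = _ := by ring

theorem solution_unique (hE : N.IsResolventFamily C W η E) (hW : N.IsCSemigroup C W)
    {u₀ : S} {v : ℝ≥0 → S} (hv : N.IsSolution (N.generator C W) u₀ v)
    (hvl : N.LocallyL0Lipschitz v) (t : ℝ≥0) : C (v t) = W t u₀ := by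
  obtain ⟨ζ, hζ, hlip⟩ := hE.lipschitz_apply hvl t
  have h := eq_of_hasDeriv_zero (f := fun r => E (t - r) (v r)) hζ hlip
    fun s hs hst => hE.hasDeriv_apply_solution hW hst ⟨v s, hv.mem_domain s⟩ rfl (hv.deriv_eq s hs)
  simp only [tsub_self, tsub_zero, hv.initial] at h
  -- Constancy on $[0,t]$ gives $E(0)v(t)=E(t)u_0$. Applying $C$ and commuting makes $E(0)$ the
  -- outer map on both sides, where it can be cancelled.
  refine hE.injective_zero hW ?_
  have h1 := congrArg C h
  rw [hE.apply_eq, hE.comm] at h1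
  rw [← hE.comm_C hW, h, hE.apply_eq, hE.comm]

end IsResolventFamily

end L0Norm

end RandomModule

theorem theorem5p1 {Ω : Type*} [MeasurableSpace Ω] (P : MeasureTheory.Measure Ω)
    [MeasureTheory.IsProbabilityMeasure P] {𝕜 : Type*} [RCLike 𝕜]
    {S : Type*} [AddCommGroup S] [Module (Ω →ₘ[P] 𝕜) S]
    (N : RandomModule.L0Norm P 𝕜 S) (hN : N.IsComplete)
    (C : S →ₗ[Ω →ₘ[P] 𝕜] S) (M ξ : Ω →ₘ[P] ℝ) (hM : 0 ≤ M)
    (W : ℝ≥0 → S →ₗ[Ω →ₘ[P] 𝕜] S) (hW : W ∈ N.H C M ξ)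
    (A : S →ₗ.[Ω →ₘ[P] 𝕜] S) (hA : A = N.generator C W)
    (η : Ω →ₘ[P] ℝ) (hη : η ∈ RandomModule.G ξ) :
    ∃ hρ : RandomModule.ofRealL0 𝕜 η ∈ RandomModule.cResolventSet C A,
      ∀ u₀ ∈ Set.range (RandomModule.cResolvent hρ),
        ∃ u : ℝ≥0 → S,
          (∀ t, C (u t) = W t u₀) ∧
          (∀ x, C x = u₀ → ∀ t, u t = W t x) ∧
          N.IsSolution A u₀ u ∧
          N.LocallyL0Lipschitz u ∧
          ∀ v : ℝ≥0 → S, N.IsSolution A u₀ v → N.LocallyL0Lipschitz v → v = u := by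
  subst hA
  obtain ⟨E, hE⟩ := RandomModule.L0Norm.exists_isResolventFamily hN hW hη
  have hW1 := hW.1
  refine ⟨hE.mem_cResolventSet hW1, ?_⟩
  rintro _ ⟨y, rfl⟩
  rw [hE.cResolvent_eq hW1]
  refine ⟨fun t => E t y, fun t => hE.apply_eq t y, fun x hx t => hW1.injective_C ?_,
    hE.isSolution hW1 y, hE.locallyL0Lipschitz y, fun v hv hvl => ?_⟩
  · rw [hE.apply_eq, ← hx, hW1.comm_C]
  · funext t
    refine hW1.injective_C ?_
    rw [hE.solution_unique hW1 hv hvl, hE.apply_eq]
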